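/- Let $d\ge 1$, let $\mathcal T_h$ be a finite conforming mesh of $d$-simplices in $\mathbb R^d$, let $\Omega$ be the interior of the union of its elements and $\mathcal F_h$ the set of the $(d-1)$-dimensional faces. Let $a\in L^\infty(\Omega)^{d\times d}$, $f\in L^2(\Omega)$, $u_D\in L^2(\partial\Omega)$; these are the data of $-\nabla\cdot(a\nabla u)=f$ in $\Omega$, $u=u_D$ on $\partial\Omega$, written as $g=\nabla u$, $q=-a\,g$, $\nabla\cdot q=f$. Given finite-dimensional polynomial spaces $V(K)$ (vector fields on $K$), $W(K)$ (functions on $K$), $M(F)$ (functions on $F$), let $V_h,W_h,M_h$ be the spaces of functions that lie in $V(K)$, $W(K)$ on each $K\in\mathcal T_h$, and in $M(F)$ on each $F\in\mathcal F_h$, with no continuity required. Write $(\cdot,\cdot)_{\mathcal T_h}=\sum_K\int_K$ and $\langle\cdot,\cdot\rangle_{\partial\mathcal T_h}=\sum_K\int_{\partial K}$, $n$ for the outward unit normal on $\partial K$, and $M_h(\eta)=\{\zeta\in M_h:\langle\zeta,\mu\rangle_{\partial\Omega}=\langle\eta,\mu\rangle_{\partial\Omega}\ \forall\mu\in M_h\}$;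 differential operators act element by element. For a bounded measurable $\tau$ on $\partial\mathcal T_h$, the HDG method seeks $(q_h,g_h,u_h,\hat u_h)\in V_h\times V_h\times W_h\times M_h$ such that, with $\hat q_h\cdot n=q_h\cdot n+\tau(u_h-\hat u_h)$, for all $(v,w,\mu)\in V_h\times W_h\times M_h$, $$-(g_h,v)_{\mathcal T_h}-(u_h,\nabla\cdot v)_{\mathcal T_h}+\langle\hat u_h,v\cdot n\rangle_{\partial\mathcal T_h}=0,\qquad (q_h,v)_{\mathcal T_h}=-(a\,g_h,v)_{\mathcal T_h},$$ $$-(q_h,\nabla w)_{\mathcal T_h}+\langle\hat q_h\cdot n,w\rangle_{\partial\mathcal T_h}=(f,w)_{\mathcal T_h},\quad \langle\mu,\hat q_h\cdot n\rangle_{\partial\mathcal T_h\setminus\partial\Omega}=0,\quad \langle\mu,\hat u_h\rangle_{\partial\Omega}=\langle\mu,u_D\rangle_{\partial\Omega}.$$ For $\mathsf w=(w,\hat w)\in L^2(\mathcal T_h)\times L^2(\partial\mathcal T_h)$ let $G_{\mathsf w},Q_{\mathsf w}\in V_h$ be given by $$-(G_{\mathsf w},v)_{\mathcal T_h}=(w,\nabla\cdot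 v)_{\mathcal T_h}-\langle\hat w,v\cdot n\rangle_{\partial\mathcal T_h},\qquad (Q_{\mathsf w},v)_{\mathcal T_h}=-(a\,G_{\mathsf w},v)_{\mathcal T_h}\qquad\forall v\in V_h.$$ The weak Galerkin (WG) scheme of Wang and Ye (2013) seeks $\mathsf u=(u_h,\hat u_h)\in W_h\times M_h$ such that, on every face $F\subset\partial\Omega$, $\hat u_h$ is the $L^2(F)$-projection of $u_D$ onto $M(F)$, and $$\sum_K (a\,\nabla_d\mathsf u,\nabla_d\mathsf w)_K=(f,w)_{\mathcal T_h}\qquad\text{for all }\mathsf w=(w,\hat w)\in W_h\times M_h\text{ with }\hat w=0\text{ on }\partial\Omega,$$ where the discrete weak gradient $\nabla_d\mathsf w\in V(K)$ is defined on each $K$ by $(\nabla_d\mathsf w,r)_K=-(w,\nabla\cdot r)_K+\langle\hat w,r\cdot n\rangle_{\partial K}$ for all $r\in V(K)$. The expanded mixed method seeks $(q_h,g_h,u_h)\in (V_h\cap H(\mathrm{div},\Omega))\times V_h\times W_h$ with $(g_h,v)_{\mathcal T_h}+(u_h,\nabla\cdot v)_{\mathcal T_h}=\langle u_D,v\cdot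 n\rangle_{\partial\Omega}$ for all $v\in V_h\cap H(\mathrm{div},\Omega)$, $(q_h,v)_{\mathcal T_h}+(a\,g_h,v)_{\mathcal T_h}=0$ for all $v\in V_h$, and $(\nabla\cdot q_h,w)_{\mathcal T_h}=(f,w)_{\mathcal T_h}$ for all $w\in W_h$. Its hybridized form seeks $(q_h,g_h,u_h,\hat u_h)\in V_h\times V_h\times W_h\times M_h$ satisfying the same last two equations together with $(g_h,v)_{\mathcal T_h}+(u_h,\nabla\cdot v)_{\mathcal T_h}=\langle\hat u_h,v\cdot n\rangle_{\partial\mathcal T_h}$ for all $v\in V_h$, $\langle\mu,q_h\cdot n\rangle_{\partial\mathcal T_h\setminus\partial\Omega}=0$ for all $\mu\in M_h$, and the condition that $\hat u_h$ is the $L^2(F)$-projection of $u_D$ onto $M(F)$ on every face $F\subset\partial\Omega$. **(1)** For arbitrary local spaces: $\mathsf w\mapsto G_{\mathsf w}$ and $\mathsf w\mapsto Q_{\mathsf w}$ are well defined and linear, and $G_{\mathsf w}|_K=\nabla_d\mathsf w$ on each $K$. For every $\tau$ as above, $(q_h,g_h,u_h,\hat u_h)$ solves the HDG method if and only if, with $\mathsf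 u=(u_h,\hat u_h)$, one has $g_h=G_{\mathsf u}$, $q_h=Q_{\mathsf u}$, $\hat u_h\in M_h(u_D)$ and $$(a\,G_{\mathsf u},G_{\mathsf w})_{\mathcal T_h}+\langle\tau(u_h-\hat u_h),w-\hat w\rangle_{\partial\mathcal T_h}=(f,w)_{\mathcal T_h}\qquad\forall\,\mathsf w=(w,\hat w)\in W_h\times M_h(0).$$ In particular, for $\tau=0$, $(q_h,g_h,u_h,\hat u_h)$ solves the HDG method if and only if $g_h=G_{\mathsf u}$, $q_h=Q_{\mathsf u}$ and $\mathsf u$ solves the WG scheme. **(2)** Let either $V(K)=[P_k]^d$, $W(K)=P_{k-1}$, $M(F)=P_k$ with $k\ge1$ (the expanded mixed method is then the BDM method of Chen, 1994), or $V(K)=[P_k]^d+xP_k$, $W(K)=P_k$, $M(F)=P_k$ with $k\ge0$ (the expanded mixed method is then the RT method of Arbogast, Wheeler and Yotov, 1997). Then $(q_h,g_h,u_h,\hat u_h)$ solves the HDG method with $\tau=0$ if and only if it solves the hybridized expanded mixed method, and if and only if $g_h=G_{\mathsf u}$, $q_h=Q_{\mathsf u}$ and $\mathsf u=(u_h,\hat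 u_h)$ solves the WG scheme. Moreover, the hybridized method is a hybridization of the expanded mixed method: if $(q_h,g_h,u_h,\hat u_h)$ solves the former then $(q_h,g_h,u_h)$ solves the latter, and for every solution $(q_h,g_h,u_h)$ of the latter there is exactly one $\hat u_h\in M_h$ such that $(q_h,g_h,u_h,\hat u_h)$ solves the former. -/

import Mathlib

open MeasureTheory
open scoped ContDiff

noncomputable section

namespace WGHDG

/-! ### Meshes -/

/-- The Euclidean space `ℝ^d`. -/
abbrev E (d : ℕ) : Type := EuclideanSpace ℝ (Fin d)

/-- A conforming simplicial mesh of `Ω ⊆ ℝ^d`: a finite geometric simplicial complex all of whose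
simplices are faces of `d`-simplices, the interior of whose underlying space is `Ω`. -/
structure Mesh (d : ℕ) (Ω : Set (E d)) where
  cx : Geometry.SimplicialComplex ℝ (E d)
  finite_faces : cx.faces.Finite
  pure : ∀ s ∈ cx.faces, ∃ t ∈ cx.faces, s ⊆ t ∧ t.card = d + 1
  interior_space : interior cx.space = Ω

namespace Mesh

variable {d : ℕ} {Ω : Set (E d)} (T : Mesh d Ω)

/-- The elements `K ∈ 𝒯_h` (given by their `d + 1` vertices). -/
def Elem : Type := {s : Finset (E d) // s ∈ T.cx.faces ∧ s.card = d + 1}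

/-- The faces `F ∈ ℱ_h`, of dimension `d - 1` (given by their `d` vertices). -/
def Face : Type := {s : Finset (E d) // s ∈ T.cx.faces ∧ s.card = d}

instance : Finite T.Elem := (T.finite_faces.subset (fun _ h => h.1)).to_subtype
instance : Finite T.Face := (T.finite_faces.subset (fun _ h => h.1)).to_subtype
instance : Fintype T.Elem := Fintype.ofFinite _
instance : Fintype T.Face := Fintype.ofFinite _

variable {T}

/-- The closed simplex `K`. -/
def Elem.set (K : T.Elem) : Set (E d) := convexHull ℝ (K.1 : Set (E d))

/-- The closed simplex `F`. -/
def Face.set (F : T.Face) : Set (E d) := convexHull ℝ (F.1 : Set (E d))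

/-- `F` lies on `∂Ω`. -/
def Face.IsBoundary (F : T.Face) : Prop := F.set ⊆ frontier Ω

open Classical in
/-- The faces of the element `K`. -/
def Elem.faces (K : T.Elem) : Finset T.Face := Finset.univ.filter fun F => F.1 ⊆ K.1

/-- The `(d - 1)`-dimensional surface measure on `F`. -/
def Face.surf (F : T.Face) : Measure F.set :=
  (Measure.euclideanHausdorffMeasure (d - 1) : Measure (E d)).comap Subtype.val

/-- A vector orthogonal to `F` and pointing out of `K`: the component orthogonal to `F` of the
vector from the barycenter of `K` to the barycenter of `F`. -/
def outward (K : T.Elem) (F : T.Face) : E d :=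
  (vectorSpan ℝ (F.1 : Set (E d)))ᗮ.starProjection
    (F.1.centroid ℝ id - K.1.centroid ℝ id)

/-- The outward unit normal `n` to `∂K` on the face `F` of `K`. -/
def normal (K : T.Elem) (F : T.Face) : E d := ‖outward K F‖⁻¹ • outward K F

end Mesh

/-! ### Polynomials -/

/-- Scalar polynomials in `d` variables. A polynomial is determined by its restriction to an
element of a mesh, since elements have nonempty interior. -/
abbrev Pol (d : ℕ) : Type := MvPolynomial (Fin d) ℝ

/-- Vector fields with polynomial components. -/
abbrev VPol (d : ℕ) : Type := Fin d → MvPolynomial (Fin d) ℝ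

section Polynomials
variable {d : ℕ}

/-- The value of a polynomial at a point. -/
def ev (p : Pol d) (x : E d) : ℝ := MvPolynomial.eval (fun i => x i) p

/-- The value of a polynomial vector field at a point. -/
def vev (v : VPol d) (x : E d) : Fin d → ℝ := fun i => ev (v i) x

/-- The divergence. -/
def pdiv (v : VPol d) : Pol d := ∑ i, MvPolynomial.pderiv i (v i)

/-- The gradient. -/
def pgrad (w : Pol d) : VPol d := fun i => MvPolynomial.pderiv i w

/-- `P_k`, the polynomials of total degree at most `k`. -/
def Pk (d k : ℕ) : Submodule ℝ (Pol d) := MvPolynomial.restrictTotalDegree (Fin d) ℝ k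

/-- `[P_k]^d`. -/
def PkVec (d k : ℕ) : Submodule ℝ (VPol d) := Submodule.pi Set.univ fun _ => Pk d k

/-- The map `p ↦ x p`. -/
def xMul (d : ℕ) : Pol d →ₗ[ℝ] VPol d :=
  LinearMap.pi fun i => LinearMap.mulLeft ℝ (MvPolynomial.X i)

/-- `[P_k]^d + x P_k`. -/
def RTk (d k : ℕ) : Submodule ℝ (VPol d) := PkVec d k ⊔ (Pk d k).map (xMul d)

/-- Restriction of polynomials to a subset of `ℝ^d`. -/
def restr (S : Set (E d)) : Pol d →ₗ[ℝ] (S → ℝ) where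
  toFun p := fun x => ev p x.1
  map_add' p q := by ext x; simp [ev]
  map_smul' c p := by ext x; simp [ev]

/-- `P_k(S)`: the functions on `S` that are restrictions of polynomials of degree at most `k`. -/
def PkOn (S : Set (E d)) (k : ℕ) : Submodule ℝ (S → ℝ) := (Pk d k).map (restr S)

instance (k : ℕ) : FiniteDimensional ℝ (Pk d k) :=
  inferInstanceAs (Module.Finite ℝ (MvPolynomial.restrictTotalDegree (Fin d) ℝ k))

instance (k : ℕ) : FiniteDimensional ℝ (PkVec d k) :=
  Module.Finite.iff_fg.2 (Submodule.fg_pi fun _ => Module.Finite.iff_fg.1 inferInstance)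

instance (k : ℕ) : FiniteDimensional ℝ (RTk d k) :=
  inferInstanceAs (FiniteDimensional ℝ (PkVec d k ⊔ (Pk d k).map (xMul d) : Submodule ℝ (VPol d)))

instance (S : Set (E d)) (k : ℕ) : FiniteDimensional ℝ (PkOn S k) :=
  inferInstanceAs (FiniteDimensional ℝ ((Pk d k).map (restr S)))

end Polynomials

/-! ### Finite element spaces -/

section Spaces
variable {d : ℕ} {Ω : Set (E d)}

/-- A choice of local spaces `V(K)`, `W(K)`, `M(F)`: finite dimensional spaces of polynomials. -/
structure LocalSpaces (T : Mesh d Ω) where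
  V : T.Elem → Submodule ℝ (VPol d)
  W : T.Elem → Submodule ℝ (Pol d)
  M : (F : T.Face) → Submodule ℝ (F.set → ℝ)
  finV : ∀ K, FiniteDimensional ℝ (V K)
  finW : ∀ K, FiniteDimensional ℝ (W K)
  finM : ∀ F, FiniteDimensional ℝ (M F)
  polM : ∀ F, M F ≤ LinearMap.range (restr F.set)

variable {T : Mesh d Ω}

/-- `V_h`: one member of `V(K)` for each element `K`. -/
abbrev LocalSpaces.Vh (L : LocalSpaces T) : Type := (K : T.Elem) → L.V K

/-- `W_h`: one member of `W(K)` for each element `K`. -/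
abbrev LocalSpaces.Wh (L : LocalSpaces T) : Type := (K : T.Elem) → L.W K

/-- `M_h`: one member of `M(F)` for each face `F`. -/
abbrev LocalSpaces.Mh (L : LocalSpaces T) : Type := (F : T.Face) → L.M F

/-- `V(K) = [P_k]^d`, `W(K) = P_{k-1}`, `M(F) = P_k` (to be used for `k ≥ 1`). -/
def bdmSpaces (T : Mesh d Ω) (k : ℕ) : LocalSpaces T where
  V _ := PkVec d k
  W _ := Pk d (k - 1)
  M F := PkOn F.set k
  finV _ := inferInstance
  finW _ := inferInstance
  finM _ := inferInstance
  polM _ := LinearMap.map_le_range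

/-- `V(K) = [P_k]^d + x P_k`, `W(K) = P_k`, `M(F) = P_k`. -/
def rtSpaces (T : Mesh d Ω) (k : ℕ) : LocalSpaces T where
  V _ := RTk d k
  W _ := Pk d k
  M F := PkOn F.set k
  finV _ := inferInstance
  finW _ := inferInstance
  finM _ := inferInstance
  polM _ := LinearMap.map_le_range

variable (T) in
/-- Scalar functions on the disjoint union of the elements. -/
abbrev VolFun : Type := T.Elem → E d → ℝ

variable (T) in
/-- Functions on `∂𝒯_h`, which may take different values on the two sides of a face. Only the
components with `F` a face of `K` are ever used. -/
abbrev BdryFun : Type := T.Elem → (F : T.Face) → F.set → ℝ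

variable {L : LocalSpaces T}

/-- A member of `W_h` as a function. -/
def volW (w : L.Wh) : VolFun T := fun K x => ev (w K).1 x

/-- The traces on `∂𝒯_h` of a member of `W_h`. -/
def trW (w : L.Wh) : BdryFun T := fun K _ x => ev (w K).1 x.1

/-- The normal traces `v · n` on `∂𝒯_h` of a member of `V_h`. -/
def trN (v : L.Vh) : BdryFun T :=
  fun K F x => vev (v K).1 x.1 ⬝ᵥ fun i => Mesh.normal K F i

/-- A member of `M_h` as a (single-valued) function on `∂𝒯_h`. -/
def trM (μ : L.Mh) : BdryFun T := fun _ F x => (μ F).1 x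

/-- `div v` for `v ∈ V_h`, element by element. -/
def volDiv (v : L.Vh) : VolFun T := fun K x => ev (pdiv (v K).1) x

/-- `(v, r)_{𝒯_h}` for scalar functions. -/
def innerVol (v r : VolFun T) : ℝ := ∑ K, ∫ x in K.set, v K x * r K x

/-- `(g, v)_{𝒯_h}` for `g, v ∈ V_h`. -/
def innerV (g v : L.Vh) : ℝ := ∑ K, ∫ x in K.set, vev (g K).1 x ⬝ᵥ vev (v K).1 x

/-- `(a g, v)_{𝒯_h}` for `g, v ∈ V_h`. -/
def innerA (a : E d → Matrix (Fin d) (Fin d) ℝ) (g v : L.Vh) : ℝ :=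
  ∑ K, ∫ x in K.set, (a x).mulVec (vev (g K).1 x) ⬝ᵥ vev (v K).1 x

/-- `(q, ∇ w)_{𝒯_h}` for `q ∈ V_h`, `w ∈ W_h`. -/
def innerGrad (q : L.Vh) (w : L.Wh) : ℝ :=
  ∑ K, ∫ x in K.set, vev (q K).1 x ⬝ᵥ vev (pgrad (w K).1) x

/-- `⟨m, r⟩_{∂𝒯_h}`. -/
def innerBdry (m r : BdryFun T) : ℝ :=
  ∑ K, ∑ F ∈ K.faces, ∫ x, m K F x * r K F x ∂F.surf

open Classical in
/-- `⟨m, r⟩_{∂𝒯_h ∖ ∂Ω}`. -/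
def innerBdryInt (m r : BdryFun T) : ℝ :=
  ∑ K, ∑ F ∈ K.faces with ¬ F.IsBoundary, ∫ x, m K F x * r K F x ∂F.surf

open Classical in
/-- `⟨η, r⟩_{∂Ω}`, for `η` on `∂Ω` and `r` given by its traces from the elements. -/
def innerBdryExt (η : E d → ℝ) (r : BdryFun T) : ℝ :=
  ∑ K, ∑ F ∈ K.faces with F.IsBoundary, ∫ x : F.set, η x.1 * r K F x ∂F.surf

open Classical in
/-- `⟨μ, ζ⟩_{∂Ω}` for `μ, ζ ∈ M_h`. -/
def innerOmega (μ ζ : L.Mh) : ℝ :=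
  ∑ F : T.Face with F.IsBoundary, ∫ x, (μ F).1 x * (ζ F).1 x ∂F.surf

open Classical in
/-- `⟨μ, η⟩_{∂Ω}` for `μ ∈ M_h` and a function `η` on `∂Ω`. -/
def innerOmegaFun (μ : L.Mh) (η : E d → ℝ) : ℝ :=
  ∑ F : T.Face with F.IsBoundary, ∫ x : F.set, (μ F).1 x * η x.1 ∂F.surf

/-- The affine space `M_h(η)` of the members of `M_h` that agree with `η` on `∂Ω` when tested
with `M_h`. -/
def MhBC (L : LocalSpaces T) (η : E d → ℝ) : Set L.Mh :=
  {ζ | ∀ μ : L.Mh, innerOmega μ ζ = innerOmegaFun μ η}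

/-- `L²(𝒯_h)`. -/
def MemL2Vol (w : VolFun T) : Prop := ∀ K, MemLp (w K) 2 (volume.restrict K.set)

/-- `L²(∂𝒯_h)`. -/
def MemL2Bdry (m : BdryFun T) : Prop := ∀ K, ∀ F ∈ K.faces, MemLp (m K F) 2 F.surf

/-- `L^∞(∂𝒯_h)`. -/
def MemLinfBdry (m : BdryFun T) : Prop := ∀ K, ∀ F ∈ K.faces, MemLp (m K F) ⊤ F.surf

end Spaces

section Methods
variable {d : ℕ} {Ω : Set (E d)} {T : Mesh d Ω}

/-! ### The HDG method based on the first order system `g = ∇u`, `q = -a g`, `∇·q = f` -/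

/-- The numerical flux `q̂_h · n = q_h · n + τ (u_h - û_h)` on `∂𝒯_h`. -/
def numFlux {L : LocalSpaces T} (τ : BdryFun T) (q : L.Vh) (u : L.Wh) (uhat : L.Mh) : BdryFun T :=
  fun K F x => trN q K F x + τ K F x * (trW u K F x - trM uhat K F x)

/-- `(q, g, u, uhat)` is a solution of the HDG method with local spaces `L` and stabilization
function `τ`. -/
structure IsHDG (L : LocalSpaces T) (a : E d → Matrix (Fin d) (Fin d) ℝ) (τ : BdryFun T)
    (f uD : E d → ℝ) (q g : L.Vh) (u : L.Wh) (uhat : L.Mh) : Prop where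
  gradient : ∀ v : L.Vh,
    -innerV g v - innerVol (volW u) (volDiv v) + innerBdry (trM uhat) (trN v) = 0
  flux : ∀ v : L.Vh, innerV q v = -innerA a g v
  conservation : ∀ w : L.Wh,
    -innerGrad q w + innerBdry (numFlux τ q u uhat) (trW w) = innerVol (fun _ => f) (volW w)
  transmission : ∀ μ : L.Mh, innerBdryInt (trM μ) (numFlux τ q u uhat) = 0
  boundary : ∀ μ : L.Mh, innerOmega μ uhat = innerOmegaFun μ uD

/-! ### The maps `G` and `Q` -/

/-- The equation defining `G_w` for `w = (w, what)`. -/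
def IsG (L : LocalSpaces T) (w : VolFun T) (what : BdryFun T) (G : L.Vh) : Prop :=
  ∀ v : L.Vh, -innerV G v = innerVol w (volDiv v) - innerBdry what (trN v)

/-- The equation defining `Q_w` from `G = G_w`. -/
def IsQ (L : LocalSpaces T) (a : E d → Matrix (Fin d) (Fin d) ℝ) (G Q : L.Vh) : Prop :=
  ∀ v : L.Vh, innerV Q v = -innerA a G v

open Classical in
/-- `G_w`, the solution of its defining equation. -/
def GMap (L : LocalSpaces T) (w : VolFun T) (what : BdryFun T) : L.Vh :=
  Classical.epsilon (IsG L w what)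

open Classical in
/-- `Q_w`, the solution of its defining equation. -/
def QMap (L : LocalSpaces T) (a : E d → Matrix (Fin d) (Fin d) ℝ) (w : VolFun T)
    (what : BdryFun T) : L.Vh :=
  Classical.epsilon (IsQ L a (GMap L w what))

/-! ### The weak Galerkin method -/

/-- `g ∈ V(K)` is the discrete weak gradient on `K` of the weak function `{v0, vb}`. -/
def IsWeakGradient (L : LocalSpaces T) (K : T.Elem) (v0 : E d → ℝ)
    (vb : (F : T.Face) → F.set → ℝ) (g : L.V K) : Prop :=
  ∀ r : L.V K, ∫ x in K.set, vev g.1 x ⬝ᵥ vev r.1 x =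
    -(∫ x in K.set, v0 x * ev (pdiv r.1) x) +
      ∑ F ∈ K.faces, ∫ x, vb F x * (vev r.1 x.1 ⬝ᵥ fun i => Mesh.normal K F i) ∂F.surf

/-- The discrete weak gradient `∇_d {v0, vb} ∈ V(K)` on `K`. -/
def weakGradient (L : LocalSpaces T) (K : T.Elem) (v0 : E d → ℝ)
    (vb : (F : T.Face) → F.set → ℝ) : L.V K :=
  Classical.epsilon (IsWeakGradient L K v0 vb)

/-- `{u0, ub} ∈ W_h × M_h` is a solution of the weak Galerkin scheme: `ub = Q_b uD` on `∂Ω`, where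
`Q_b` is the `L²(F)`-projection onto `M(F)` on each face, and
`∑_K (a ∇_d u, ∇_d v)_K = (f, v0)` for all `v = {v0, vb}` with `vb = 0` on `∂Ω`. -/
structure IsWG (L : LocalSpaces T) (a : E d → Matrix (Fin d) (Fin d) ℝ) (f uD : E d → ℝ)
    (u0 : L.Wh) (ub : L.Mh) : Prop where
  boundary : ∀ F : T.Face, F.IsBoundary → ∀ μ : L.M F,
    ∫ x, (ub F).1 x * μ.1 x ∂F.surf = ∫ x : F.set, uD x.1 * μ.1 x ∂F.surf
  scheme : ∀ (v0 : L.Wh) (vb : L.Mh), (∀ F : T.Face, F.IsBoundary → vb F = 0) →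
    ∑ K, ∫ x in K.set,
      (a x).mulVec (vev (weakGradient L K (volW u0 K) (fun F => (ub F).1)).1 x) ⬝ᵥ
        vev (weakGradient L K (volW v0 K) (fun F => (vb F).1)).1 x =
    ∑ K, ∫ x in K.set, f x * volW v0 K x

/-! ### Expanded mixed methods and their hybridization -/

/-- `H(div, Ω)`: square integrable fields with square integrable weak divergence. -/
def InHDiv (Ω : Set (E d)) (v : E d → E d) : Prop :=
  MemLp v 2 (volume.restrict Ω) ∧
  ∃ r : E d → ℝ, MemLp r 2 (volume.restrict Ω) ∧
    ∀ φ : E d → ℝ, ContDiff ℝ ∞ φ → HasCompactSupport φ → tsupport φ ⊆ Ω →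
      ∫ x in Ω, inner ℝ (v x) (gradient φ x) = -∫ x in Ω, r x * φ x

/-- The vector field on `ℝ^d` (zero outside of the interiors of the elements) given by a member of
`V_h`. -/
def glue {L : LocalSpaces T} (v : L.Vh) : E d → E d := fun x =>
  ∑ K : T.Elem, (interior K.set).indicator (fun y => WithLp.toLp 2 (vev (v K).1 y)) x

/-- `V_h ∩ H(div, Ω)`. -/
def ConformingV (L : LocalSpaces T) : Set L.Vh := {v | InHDiv Ω (glue v)}

/-- `(q, g, u)` is a solution of the expanded mixed method with flux space `V_h ∩ H(div, Ω)`,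
gradient space `V_h` and scalar space `W_h`. -/
structure IsExpandedMixed (L : LocalSpaces T) (a : E d → Matrix (Fin d) (Fin d) ℝ)
    (f uD : E d → ℝ) (q g : L.Vh) (u : L.Wh) : Prop where
  conforming : q ∈ ConformingV L
  gradient : ∀ v ∈ ConformingV L,
    innerV g v + innerVol (volW u) (volDiv v) = innerBdryExt uD (trN v)
  flux : ∀ v : L.Vh, innerV q v + innerA a g v = 0
  conservation : ∀ w : L.Wh, innerVol (volDiv q) (volW w) = innerVol (fun _ => f) (volW w)

/-- `(q, g, u, uhat)` is a solution of the hybridized form of the expanded mixed method: the fluxes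
are no longer required to be in `H(div, Ω)`; the continuity of their normal component across the
interior faces is imposed by the multiplier `uhat ∈ M_h`, which is the `L²(F)`-projection
of `uD` on the faces on `∂Ω`. -/
structure IsHybridMixed (L : LocalSpaces T) (a : E d → Matrix (Fin d) (Fin d) ℝ)
    (f uD : E d → ℝ) (q g : L.Vh) (u : L.Wh) (uhat : L.Mh) : Prop where
  gradient : ∀ v : L.Vh,
    innerV g v + innerVol (volW u) (volDiv v) = innerBdry (trM uhat) (trN v)
  flux : ∀ v : L.Vh, innerV q v + innerA a g v = 0
  conservation : ∀ w : L.Wh, innerVol (volDiv q) (volW w) = innerVol (fun _ => f) (volW w)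
  continuity : ∀ μ : L.Mh, innerBdryInt (trM μ) (trN q) = 0
  boundary : ∀ F : T.Face, F.IsBoundary → ∀ μ : L.M F,
    ∫ x, (uhat F).1 x * μ.1 x ∂F.surf = ∫ x : F.set, uD x.1 * μ.1 x ∂F.surf

end Methods

end WGHDG

end

/-! Part (1) is linear algebra over the elements. `V_h` is a product of the spaces `V(K)`, so
testing with fields supported on one element splits the equations for `G` and `Q` into local ones
(`pi_sum_eq_iff`). The `L²(K)` form is definite on polynomials because an element has interior
points, so each local problem has exactly one solution (`existsUnique_riesz`). The local equation
for `G` is the one that defines the discrete weak gradient. For `g = G_u` and `q = Q_u`, testing the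
equation of `Q_u` with `G_w` and that of `G_w` with `q` gives `(a G_u, G_w) = (w, ∇·q) - ⟨ŵ, q·n⟩`.
Integration by parts turns this, with the `τ` term added, into the left side of the conservation
equation minus that of the transmission equation. Since `M_h(0)` consists of the multipliers that
vanish on boundary faces, `w` and `ŵ` can be varied separately, which gives the equivalence in
`isHDG_iff`; `τ = 0` leaves the WG scheme.

In part (2) the flux for `τ = 0` is `q·n`, and integration by parts gives the hybridized method.
That this is a hybridization rests on two facts. First, `V_h ∩ H(div, Ω)` is the set of `v` with
`⟨μ, v·n⟩ = 0` over interior faces for all `μ`: the distributional divergence of `v` has a singular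
part carried by the normal jumps (`integral_glue_gradient`), and the jumps themselves lie in `M(F)`.
Secondly, each member of `M(F)` is a normal trace from `V(K)` vanishing on the other faces
(`HasNormalTraces`), so the pairing of `M_h` with `V_h` determines the multiplier. The multiplier
exists because a functional on `V_h` that vanishes on the conforming fields is, in finite dimension,
given by an interior multiplier.

The analytic tool is the Gauss theorem on a simplex, proved from Fubini and the one-dimensional
fundamental theorem along edge directions (`Elem.setIntegral_fderiv_edge`). -/

namespace WGHDG

/-! ### Definiteness of the `L²` form on convex bodies. -/

section Convex
variable {V : Type*} [NormedAddCommGroup V] [NormedSpace ℝ V]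
  [MeasurableSpace V] [BorelSpace V] (μ : Measure V) [μ.IsAddHaarMeasure]

/-- The square vanishes almost everywhere, hence by continuity at every interior point. A convex set
with nonempty interior lies in the closure of that interior, which settles the boundary points. -/
theorem _root_.Convex.eqOn_zero_of_setIntegral_sq_eq_zero {D : Set V} (hD : Convex ℝ D)
    (hc : IsCompact D) (hi : (interior D).Nonempty) {f : V → ℝ} (hf : Continuous f)
    (h : ∫ x in D, f x * f x ∂μ = 0) : ∀ x ∈ D, f x = 0 := by
  have hint : IntegrableOn (fun x => f x * f x) D μ := (hf.mul hf).continuousOn.integrableOn_compact hc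
  rw [setIntegral_eq_zero_iff_of_nonneg_ae
    (Filter.Eventually.of_forall fun x => mul_self_nonneg (f x)) hint] at h
  have h1 : (fun x => f x * f x) =ᵐ[μ.restrict (interior D)] fun _ => 0 :=
    ae_restrict_of_ae_restrict_of_subset interior_subset h
  have h2 := Measure.eqOn_open_of_ae_eq h1 isOpen_interior (hf.mul hf).continuousOn
    continuous_const.continuousOn
  have h3 : D ⊆ closure (interior D) := by
    rw [hD.closure_interior_eq_closure_of_nonempty_interior hi]; exact subset_closure
  intro x hx
  have h4 : Set.EqOn f (fun _ => 0) (interior D) := fun y hy => by simpa using h2 hy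
  exact h4.closure hf continuous_const (h3 hx)

end Convex

/-! ### Geometry and measures of elements and faces. -/

namespace Mesh

variable {d : ℕ} {Ω : Set (E d)} {T : Mesh d Ω}

section Elem
variable (K : T.Elem)

theorem Elem.affineIndependent : AffineIndependent ℝ ((↑) : K.1 → E d) := T.cx.indep K.2.1

/-- The vertices of an element form an affine basis of `ℝ^d`. -/
noncomputable def Elem.basis : AffineBasis K.1 ℝ (E d) where
  toFun := (↑)
  ind' := K.affineIndependent
  tot' := by
    rw [K.affineIndependent.affineSpan_eq_top_iff_card_eq_finrank_add_one]
    simp [K.2.2]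

@[simp] theorem Elem.basis_apply (i : K.1) : K.basis i = i.1 := rfl

theorem Elem.range_basis : Set.range K.basis = (K.1 : Set (E d)) := by
  ext x; simp

theorem Elem.convex_set : Convex ℝ K.set := convex_convexHull ℝ _

theorem Elem.isCompact_set : IsCompact K.set := K.1.finite_toSet.isCompact_convexHull ℝ

theorem Elem.measurableSet_set : MeasurableSet K.set := K.isCompact_set.measurableSet

theorem Elem.set_eq : K.set = {x | ∀ i, 0 ≤ K.basis.coord i x} := by
  rw [← K.basis.convexHull_eq_nonneg_coord, K.range_basis]; rfl

theorem Elem.interior_nonempty : (interior K.set).Nonempty := by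
  rw [Elem.set, interior_convexHull_nonempty_iff_affineSpan_eq_top, ← K.range_basis]
  exact K.basis.tot

theorem Elem.volume_frontier : volume (frontier K.set) = 0 :=
  K.convex_set.addHaar_frontier volume

theorem Elem.interior_ae_eq : interior K.set =ᵐ[volume] K.set :=
  interior_ae_eq_of_null_frontier K.volume_frontier

theorem Elem.set_subset_space : K.set ⊆ T.cx.space :=
  Geometry.SimplicialComplex.convexHull_subset_space K.2.1

theorem Elem.interior_subset : interior K.set ⊆ Ω := by
  exact (interior_mono K.set_subset_space).trans T.interior_space.subset

theorem Elem.restrict_interior :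
    volume.restrict (interior K.set) = volume.restrict K.set :=
  Measure.restrict_congr_set K.interior_ae_eq

/-- The closed simplex can touch `∂Ω`, but only in its own frontier, which is null by convexity.
Data given on `Ω` can therefore be integrated over `K.set`. -/
theorem Elem.restrict_le : volume.restrict K.set ≤ volume.restrict Ω := by
  rw [← K.restrict_interior]
  exact Measure.restrict_mono K.interior_subset le_rfl

instance : IsFiniteMeasure (volume.restrict K.set) :=
  ⟨by simpa using K.isCompact_set.measure_lt_top⟩

theorem Elem.set_subset_closure : K.set ⊆ closure Ω := by
  refine Set.Subset.trans ?_ (closure_mono K.interior_subset)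
  rw [K.convex_set.closure_interior_eq_closure_of_nonempty_interior K.interior_nonempty]
  exact subset_closure

theorem isOpen (T : Mesh d Ω) : IsOpen Ω := by rw [← T.interior_space]; exact isOpen_interior

end Elem

section Face
variable (F : T.Face)

theorem Face.nonempty : F.1.Nonempty := T.cx.nonempty_of_mem_faces F.2.1

/-- A vertex of the face. -/
noncomputable def Face.pt : E d := F.nonempty.choose

theorem Face.pt_mem : F.pt ∈ F.1 := F.nonempty.choose_spec

theorem Face.affineIndependent : AffineIndependent ℝ ((↑) : F.1 → E d) := T.cx.indep F.2.1

/-- The direction of the hyperplane spanned by the face. -/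
noncomputable abbrev Face.dir : Submodule ℝ (E d) := vectorSpan ℝ (F.1 : Set (E d))

theorem Face.one_le_dim (F : T.Face) : 1 ≤ d := by
  have := F.nonempty.card_pos
  have := F.2.2
  omega

theorem Face.finrank_dir : Module.finrank ℝ F.dir = d - 1 := by
  have h := F.affineIndependent.finrank_vectorSpan (n := d - 1) (by
    have := F.one_le_dim
    simp [F.2.2]; omega)
  have e : vectorSpan ℝ (Set.range ((↑) : F.1 → E d)) = F.dir :=
    congrArg (vectorSpan ℝ) Subtype.range_coe
  rwa [e] at h

/-- The parametrization of the hyperplane spanned by the face by its direction. -/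
noncomputable def Face.param : F.dir →ᵃ[ℝ] E d :=
  F.dir.subtype.toAffineMap + AffineMap.const ℝ F.dir F.pt

@[simp] theorem Face.param_apply (z : F.dir) : F.param z = z + F.pt := by simp [Face.param]

theorem Face.isometry_param : Isometry F.param :=
  Isometry.of_dist_eq fun z w => by simp [Subtype.dist_eq]

theorem Face.range_param : Set.range F.param = affineSpan ℝ (F.1 : Set (E d)) := by
  ext x
  rw [SetLike.mem_coe, ← AffineSubspace.vsub_right_mem_direction_iff_mem
    (subset_affineSpan ℝ _ F.pt_mem), direction_affineSpan]
  constructor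
  · rintro ⟨z, rfl⟩; simp
  · intro h; exact ⟨⟨_, h⟩, by simp⟩

theorem Face.set_subset_range : F.set ⊆ Set.range F.param := by
  rw [F.range_param]; exact convexHull_subset_affineSpan _

theorem Face.isCompact_set : IsCompact F.set := F.1.finite_toSet.isCompact_convexHull ℝ

theorem Face.measurableSet_set : MeasurableSet F.set := F.isCompact_set.measurableSet

instance : CompactSpace F.set := isCompact_iff_compactSpace.1 F.isCompact_set

/-- The face as a subset of the direction of its hyperplane. -/
noncomputable def Face.dom : Set F.dir := F.param ⁻¹' F.set

theorem Face.convex_dom : Convex ℝ F.dom := (convex_convexHull ℝ _).affine_preimage _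

theorem Face.isCompact_dom : IsCompact F.dom :=
  F.isometry_param.isClosedEmbedding.isCompact_preimage F.isCompact_set

theorem Face.measurableSet_dom : MeasurableSet F.dom := F.isCompact_dom.measurableSet

/-- Read in `F.dir`, a face becomes a full-dimensional simplex, to which statements on interiors and
Lebesgue measure apply. Hulls commute with the injective affine map `F.param` because `s` lies in
its range. -/
theorem Face.preimage_convexHull {s : Set (E d)} (hs : s ⊆ (F.1 : Set (E d))) :
    F.param ⁻¹' (convexHull ℝ s) = convexHull ℝ (F.param ⁻¹' s) := by
  have h1 : s ⊆ Set.range F.param :=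
    hs.trans ((subset_convexHull ℝ _).trans F.set_subset_range)
  rw [← Set.image_preimage_eq_of_subset h1, ← AffineMap.image_convexHull,
    Set.preimage_image_eq _ F.isometry_param.injective,
    Set.preimage_image_eq _ F.isometry_param.injective]

theorem Face.affineSpan_preimage_eq_top_iff {s : Set (E d)} (hs : s ⊆ (F.1 : Set (E d))) :
    affineSpan ℝ (F.param ⁻¹' s) = ⊤ ↔ affineSpan ℝ s = affineSpan ℝ (F.1 : Set (E d)) := by
  have h1 : s ⊆ Set.range F.param :=
    hs.trans ((subset_convexHull ℝ _).trans F.set_subset_range)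
  have h2 : affineSpan ℝ (F.1 : Set (E d)) = (⊤ : AffineSubspace ℝ F.dir).map F.param := by
    apply SetLike.coe_injective; rw [← F.range_param, AffineSubspace.coe_map]; simp only [AffineSubspace.top_coe, Set.image_univ]
  have h3 : affineSpan ℝ s = (affineSpan ℝ (F.param ⁻¹' s)).map F.param := by
    rw [AffineSubspace.map_span, Set.image_preimage_eq_of_subset h1]
  rw [h2, h3]
  constructor
  · intro h; rw [h]
  · intro h
    apply SetLike.coe_injective
    have := congrArg (fun s : AffineSubspace ℝ (E d) => (s : Set (E d))) h
    simp only [AffineSubspace.coe_map] at this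
    exact F.isometry_param.injective.image_injective this

theorem Face.interior_dom_nonempty : (interior F.dom).Nonempty := by
  rw [Face.dom, Face.set, F.preimage_convexHull subset_rfl,
    interior_convexHull_nonempty_iff_affineSpan_eq_top,
    F.affineSpan_preimage_eq_top_iff subset_rfl]

/-- By affine independence a proper subset of the vertices does not span the hyperplane of `F`. This
later makes the intersection of two distinct faces a null set. -/
theorem Face.interior_preimage_convexHull_eq_empty {s : Set (E d)} (hs : s ⊂ (F.1 : Set (E d))) :
    interior (F.param ⁻¹' (convexHull ℝ s)) = ∅ := by
  rw [← Set.not_nonempty_iff_eq_empty, F.preimage_convexHull hs.1,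
    interior_convexHull_nonempty_iff_affineSpan_eq_top, F.affineSpan_preimage_eq_top_iff hs.1]
  intro h
  obtain ⟨x, hx, hxs⟩ := Set.exists_of_ssubset hs
  have h1 := F.affineIndependent.notMem_affineSpan_sdiff ⟨x, hx⟩ Set.univ
  apply h1
  have h2 : s ⊆ (↑) '' ((Set.univ : Set F.1) \ {⟨x, hx⟩}) := by
    intro y hy
    exact ⟨⟨y, hs.1 hy⟩, ⟨trivial, fun h => by
      obtain rfl : y = x := congrArg Subtype.val (Set.mem_singleton_iff.1 h)
      exact hxs hy⟩, rfl⟩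
  exact affineSpan_mono ℝ h2 (h ▸ subset_affineSpan ℝ _ hx)

/-- Isometries preserve Hausdorff measure, and on `F.dir`, of dimension `d - 1`, it is Lebesgue
measure. Surface integrals thus become Lebesgue integrals over `F.dom`. -/
theorem Face.map_param :
    (volume : Measure F.dir).map F.param =
      (Measure.euclideanHausdorffMeasure (d - 1) : Measure (E d)).restrict (Set.range F.param) := by
  rw [← F.isometry_param.map_euclideanHausdorffMeasure,
    ← InnerProductSpace.euclideanHausdorffMeasure_eq_volume, F.finrank_dir]

theorem Face.setIntegral_eq (g : E d → ℝ) :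
    ∫ x in F.set, g x ∂(Measure.euclideanHausdorffMeasure (d - 1)) = ∫ z in F.dom, g (F.param z) := by
  have h := F.isometry_param.isClosedEmbedding.measurableEmbedding.setIntegral_map
    (μ := volume) g F.set
  rw [F.map_param, Measure.restrict_restrict F.measurableSet_set,
    Set.inter_eq_left.2 F.set_subset_range] at h
  exact h

theorem Face.integral_surf (g : E d → ℝ) :
    ∫ x : F.set, g x.1 ∂F.surf = ∫ z in F.dom, g (F.param z) := by
  rw [← F.setIntegral_eq, Face.surf, integral_subtype_comap F.measurableSet_set]

instance : IsFiniteMeasure F.surf := by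
  constructor
  rw [Face.surf, Measure.comap_apply _ Subtype.val_injective
    (fun s hs => F.measurableSet_set.subtype_image hs) _ MeasurableSet.univ]
  have h : (Measure.euclideanHausdorffMeasure (d - 1) : Measure (E d)) F.set =
      volume F.dom := by
    have := congrArg (fun m => m F.set) F.map_param
    simp only at this
    rw [F.isometry_param.isClosedEmbedding.measurableEmbedding.map_apply,
      Measure.restrict_apply F.measurableSet_set, Set.inter_eq_left.2 F.set_subset_range] at this
    exact this.symm
  simp only [Set.image_univ, Subtype.range_coe_subtype, Set.ofPred_mem_eq]
  rw [h]
  exact F.isCompact_dom.measure_lt_top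

theorem Face.eq_zero_of_integral_sq {g : E d → ℝ} (hg : Continuous g)
    (h : ∫ x : F.set, g x.1 * g x.1 ∂F.surf = 0) : ∀ x ∈ F.set, g x = 0 := by
  rw [F.integral_surf fun x => g x * g x] at h
  have h1 := F.convex_dom.eqOn_zero_of_setIntegral_sq_eq_zero volume F.isCompact_dom
    F.interior_dom_nonempty (hg.comp F.isometry_param.continuous) h
  intro x hx
  obtain ⟨z, rfl⟩ := F.set_subset_range hx
  exact h1 z hx

end Face

section Incidence

theorem Elem.mem_faces {K : T.Elem} {F : T.Face} : F ∈ K.faces ↔ F.1 ⊆ K.1 := by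
  simp [Elem.faces]

theorem Face.exists_elem (F : T.Face) : ∃ K : T.Elem, F ∈ K.faces := by
  obtain ⟨t, ht, hs, hc⟩ := T.pure F.1 F.2.1
  exact ⟨⟨t, ht, hc⟩, Elem.mem_faces.2 hs⟩

theorem Face.set_subset_elem {K : T.Elem} {F : T.Face} (h : F ∈ K.faces) : F.set ⊆ K.set :=
  convexHull_mono (Finset.coe_subset.2 (Elem.mem_faces.1 h))

theorem Face.exists_opposite {K : T.Elem} {F : T.Face} (h : F ∈ K.faces) :
    ∃ v ∈ K.1, v ∉ F.1 ∧ ∀ y ∈ K.1, y ≠ v → y ∈ F.1 := by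
  classical
  have h1 := Elem.mem_faces.1 h
  have h2 : (K.1 \ F.1).card = 1 := by
    rw [Finset.card_sdiff_of_subset h1, K.2.2, F.2.2]; omega
  obtain ⟨v, hv⟩ := Finset.card_eq_one.1 h2
  have hv' : ∀ y, y ∈ K.1 \ F.1 ↔ y = v := fun y => by rw [hv]; simp
  refine ⟨v, ?_, ?_, ?_⟩
  · exact (Finset.mem_sdiff.1 ((hv' v).2 rfl)).1
  · exact (Finset.mem_sdiff.1 ((hv' v).2 rfl)).2
  · intro y hy hyv
    by_contra hF
    exact hyv ((hv' y).1 (Finset.mem_sdiff.2 ⟨hy, hF⟩))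

end Incidence
end Mesh

/-! ### The Gauss theorem on half-cylinders. -/

section HalfCylinder
variable {V : Type*} [NormedAddCommGroup V] [InnerProductSpace ℝ V] [FiniteDimensional ℝ V]
  [MeasurableSpace V] [BorelSpace V]

/-- Oblique coordinates with respect to a hyperplane are volume preserving if the transversal
direction has unit component along the normal. -/
theorem measurePreserving_oblique (S : Submodule ℝ V) (hS : Module.finrank ℝ Sᗮ = 1) (p : V)
    {m e : V} (hm : m ∈ Sᗮ) (hm1 : ‖m‖ = 1) (he : inner ℝ e m = 1) :
    MeasurePreserving (fun tz : ℝ × S => (tz.2 : V) + p + tz.1 • e)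
      ((volume : Measure ℝ).prod (volume : Measure S)) volume := by
  -- `Sᗮ` is the line of `m`, and `e - m` has no component along it. So the oblique coordinates are
  -- a shear `z ↦ z + t (e - m)` followed by orthogonal coordinates, and both preserve volume.
  have hem : e - m ∈ S := by
    rw [← Submodule.orthogonal_orthogonal S, Submodule.mem_orthogonal]
    intro u hu
    obtain ⟨c, hc⟩ := (finrank_eq_one_iff_of_nonzero' (⟨m, hm⟩ : Sᗮ)
      (by intro h; simp at h; simp [h] at hm1)).1 hS ⟨u, hu⟩
    have hc' : u = c • m := (congrArg Subtype.val hc).symm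
    rw [hc', inner_smul_left, inner_sub_right, real_inner_comm, he, real_inner_self_eq_norm_sq, hm1]
    simp
  have h1 : MeasurePreserving (fun tz : ℝ × S => (tz.1, tz.2 + tz.1 • (⟨e - m, hem⟩ : S)))
      ((volume : Measure ℝ).prod (volume : Measure S)) (volume.prod volume) := by
    refine (MeasurePreserving.id volume).skew_product (g := fun t z => z + t • (⟨e - m, hem⟩ : S))
      (by fun_prop) (Filter.Eventually.of_forall fun t => ?_)
    exact (measurePreserving_add_right volume _).map_eq
  have h2 : MeasurePreserving (fun t : ℝ => t • (⟨m, hm⟩ : Sᗮ)) volume volume := by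
    refine ⟨by fun_prop, ?_⟩
    have := volume_eq_of_finrank_eq_one hS (v := ⟨m, hm⟩)
      (by intro h; simp at h; simp [h] at hm1)
    have hn : ‖(⟨m, hm⟩ : Sᗮ)‖ₑ = 1 := by
      rw [← ofReal_norm]; simp [hm1]
    rw [this, hn, one_smul]
  have h3 := (h2.prod (MeasurePreserving.id (volume : Measure S))).comp h1
  have h4 := (Measure.measurePreserving_swap (μ := (volume : Measure Sᗮ))
    (ν := (volume : Measure S))).comp h3
  have h5 := ((S.measurePreserving_measurableEquivProd p).symm).comp h4
  rw [InnerProductSpace.euclideanHausdorffMeasure_eq_volume] at h5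
  convert! h5 using 1
  ext tz
  simp
  module

/-- `hAD` says that `A` is the half-cylinder over `D` in direction `e`, up to the null slice `t =
0`. Fubini in oblique coordinates reduces the integral to half-lines; there compact support kills
the end at infinity and `-Φ` at the base remains. -/
theorem setIntegral_fderiv_halfCylinder_of_unit (S : Submodule ℝ V)
    (hS : Module.finrank ℝ Sᗮ = 1) (p : V)
    {m e : V} (hm : m ∈ Sᗮ) (hm1 : ‖m‖ = 1) (he : inner ℝ e m = 1)
    {A : Set V} (hA : MeasurableSet A) {D : Set S} (hD : MeasurableSet D)
    (hAD : ∀ (z : S) (t : ℝ), t ≠ 0 → ((z : V) + p + t • e ∈ A ↔ z ∈ D ∧ 0 < t))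
    {Φ : V → ℝ} (hΦ : ContDiff ℝ 1 Φ) (hc : HasCompactSupport Φ) :
    ∫ x in A, fderiv ℝ Φ x e = -∫ z in D, Φ (z + p) := by
  have hmp := measurePreserving_oblique S hS p hm hm1 he
  have he0 : e ≠ 0 := by rintro rfl; simp at he
  set G : V → ℝ := A.indicator fun x => fderiv ℝ Φ x e with hG
  have hcont : Continuous fun x => fderiv ℝ Φ x e :=
    (hΦ.continuous_fderiv one_ne_zero).clm_apply continuous_const
  have hGint : Integrable G := by
    refine (hcont.integrable_of_hasCompactSupport ?_).indicator hA
    exact hc.fderiv_apply ℝ e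
  rw [← integral_indicator hA, ← hG, ← hmp.map_eq,
    integral_map hmp.measurable.aemeasurable (by rw [hmp.map_eq]; exact hGint.aestronglyMeasurable),
    integral_prod_symm (fun tz : ℝ × S => G ((tz.2 : V) + p + tz.1 • e))
      (hmp.integrable_comp_of_integrable hGint), ← integral_neg,
    ← integral_indicator hD]
  congr 1
  ext z
  have hline : Topology.IsClosedEmbedding fun t : ℝ => (z : V) + p + t • e :=
    (Homeomorph.addLeft ((z : V) + p)).isClosedEmbedding.comp (isClosedEmbedding_smul_left he0)
  have hΦline : ContDiff ℝ 1 fun t : ℝ => Φ ((z : V) + p + t • e) := hΦ.comp (by fun_prop)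
  have hder : ∀ t : ℝ, deriv (fun t : ℝ => Φ ((z : V) + p + t • e)) t =
      fderiv ℝ Φ ((z : V) + p + t • e) e := by
    intro t
    have h1 : HasDerivAt (fun t : ℝ => (z : V) + p + t • e) e t := by
      simpa using ((hasDerivAt_id t).smul_const e).const_add ((z : V) + p)
    exact ((hΦ.differentiable one_ne_zero _).hasFDerivAt.comp_hasDerivAt t h1).deriv
  have hfin : ∫ t in Set.Ioi (0 : ℝ), fderiv ℝ Φ ((z : V) + p + t • e) e = -Φ (z + p) := by
    have := HasCompactSupport.integral_Ioi_deriv_eq hΦline (hc.comp_isClosedEmbedding hline) 0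
    simpa [hder] using this
  have h0 : ∀ᵐ t : ℝ, t ≠ 0 := by simp [ae_iff]
  by_cases hz : z ∈ D
  · rw [Set.indicator_of_mem hz, ← hfin, ← integral_indicator measurableSet_Ioi]
    refine integral_congr_ae ?_
    filter_upwards [h0] with t ht
    by_cases ht' : t ∈ Set.Ioi 0
    · rw [hG, Set.indicator_of_mem ((hAD z t ht).2 ⟨hz, ht'⟩), Set.indicator_of_mem ht']
    · rw [hG, Set.indicator_of_notMem (fun h => ht' ((hAD z t ht).1 h).2),
        Set.indicator_of_notMem ht']
  · rw [Set.indicator_of_notMem hz]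
    refine integral_eq_zero_of_ae ?_
    filter_upwards [h0] with t ht
    rw [hG, Set.indicator_of_notMem (fun h => hz ((hAD z t ht).1 h).1)]
    rfl

theorem setIntegral_fderiv_halfCylinder (S : Submodule ℝ V)
    (hS : Module.finrank ℝ Sᗮ = 1) (p : V)
    {m e : V} (hm : m ∈ Sᗮ) (hm1 : ‖m‖ = 1) (he : 0 < inner ℝ e m)
    {A : Set V} (hA : MeasurableSet A) {D : Set S} (hD : MeasurableSet D)
    (hAD : ∀ (z : S) (t : ℝ), t ≠ 0 → ((z : V) + p + t • e ∈ A ↔ z ∈ D ∧ 0 < t))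
    {Φ : V → ℝ} (hΦ : ContDiff ℝ 1 Φ) (hc : HasCompactSupport Φ) :
    ∫ x in A, fderiv ℝ Φ x e = -(inner ℝ e m * ∫ z in D, Φ (z + p)) := by
  set c : ℝ := inner ℝ e m with hcdef
  -- Dividing by `c` makes the component along `m` equal to one; the line parameter is rescaled by a
  -- positive factor, so the half-lines are unchanged.
  have h := setIntegral_fderiv_halfCylinder_of_unit S hS p (e := c⁻¹ • e) hm hm1
    (by rw [inner_smul_left, ← hcdef]; simp [he.ne']) hA hD (fun z t ht => by
      rw [smul_smul, hAD z (t * c⁻¹) (mul_ne_zero ht (inv_ne_zero he.ne')),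
        mul_pos_iff_of_pos_right (inv_pos.2 he)]) hΦ hc
  simp only [map_smul, smul_eq_mul] at h
  rw [integral_const_mul] at h
  rw [← mul_neg, ← h]
  field_simp

end HalfCylinder
-- Outward normals and the Gauss theorem on a simplex.
namespace Mesh
variable {d : ℕ} {Ω : Set (E d)} {T : Mesh d Ω}

theorem centroid_eq {s : Finset (E d)} (hs : s.Nonempty) :
    s.centroid ℝ id = (s.card : ℝ)⁻¹ • ∑ x ∈ s, x := by
  rw [Finset.centroid_def, Finset.affineCombination_eq_linear_combination _ _ _
    (s.sum_centroidWeights_eq_one_of_nonempty ℝ hs), Finset.smul_sum]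
  simp

/-- The barycenter of `K` is `(v + d c) / (d + 1)`, with `c` the barycenter of `F`, so the two
barycenters differ by `(c - v) / (d + 1)`. Replacing `c` by the vertex `y` changes this by a vector
of `F.dir`, which the projection kills. -/
theorem outward_eq {K : T.Elem} {F : T.Face} {v : E d} (hF : F.1 ⊆ K.1)
    (hvK : v ∈ K.1) (hvF : v ∉ F.1) (hv : ∀ y ∈ K.1, y ≠ v → y ∈ F.1) {y : E d} (hy : y ∈ F.1) :
    outward K F = ((d : ℝ) + 1)⁻¹ • F.dirᗮ.starProjection (y - v) := by
  classical
  have hK : K.1 = insert v F.1 := by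
    ext z
    simp only [Finset.mem_insert]
    constructor
    · intro hz
      by_cases h : z = v
      · exact Or.inl h
      · exact Or.inr (hv z hz h)
    · rintro (rfl | hz)
      · exact hvK
      · exact hF hz
  have hd : (d : ℝ) ≠ 0 := by
    have := F.one_le_dim
    positivity
  have hd1 : (d : ℝ) + 1 ≠ 0 := by positivity
  have hcF := centroid_eq F.nonempty
  have hcK : K.1.centroid ℝ id = ((d : ℝ) + 1)⁻¹ • (v + ∑ x ∈ F.1, x) := by
    rw [centroid_eq ⟨v, hvK⟩, K.2.2]
    have hsum : ∑ x ∈ K.1, x = v + ∑ x ∈ F.1, x := by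
      exact (congrArg (fun s : Finset (E d) => ∑ x ∈ s, x) hK).trans (Finset.sum_insert hvF)
    rw [hsum]
    push_cast
    rfl
  rw [F.2.2] at hcF
  have h1 : F.1.centroid ℝ id - K.1.centroid ℝ id =
      ((d : ℝ) + 1)⁻¹ • ((F.1.centroid ℝ id - y) + (y - v)) := by
    have hs : ∑ x ∈ F.1, x = (d : ℝ) • F.1.centroid ℝ id := by
      rw [hcF, smul_smul, mul_inv_cancel₀ hd, one_smul]
    have h2 : F.1.centroid ℝ id = ((d : ℝ) + 1)⁻¹ • (((d : ℝ) + 1) • F.1.centroid ℝ id) := by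
      rw [smul_smul, inv_mul_cancel₀ hd1, one_smul]
    rw [hcK, hs]
    nth_rewrite 1 [h2]
    module
  have h2 : F.1.centroid ℝ id - y ∈ F.dir := by
    have h3 : F.1.centroid ℝ id - y = (d : ℝ)⁻¹ • ∑ x ∈ F.1, (x - y) := by
      rw [Finset.sum_sub_distrib, Finset.sum_const, F.2.2, smul_sub, ← hcF, ← Nat.cast_smul_eq_nsmul ℝ,
        smul_smul, inv_mul_cancel₀ hd, one_smul]
    rw [h3]
    exact Submodule.smul_mem _ _ (Submodule.sum_mem _ fun x hx => vsub_mem_vectorSpan ℝ hx hy)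
  rw [outward, h1, map_smul, map_add,
    (Submodule.starProjection_apply_eq_zero_iff (K := F.dirᗮ)).2, zero_add]
  rwa [Submodule.orthogonal_orthogonal]

theorem normal_mem_orthogonal (K : T.Elem) (F : T.Face) : normal K F ∈ F.dirᗮ :=
  Submodule.smul_mem _ _ (Submodule.starProjection_apply_mem _ _)

theorem opposite_sub_notMem_dir {K : T.Elem} {F : T.Face} {v : E d} (hF : F.1 ⊆ K.1)
    (hvK : v ∈ K.1) (hvF : v ∉ F.1) {y : E d} (hy : y ∈ F.1) : y - v ∉ F.dir := by
  intro h
  have h1 : v ∈ affineSpan ℝ (F.1 : Set (E d)) := by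
    rw [← AffineSubspace.vsub_left_mem_direction_iff_mem (subset_affineSpan ℝ _ hy),
      direction_affineSpan]
    exact h
  refine K.affineIndependent.notMem_affineSpan_sdiff ⟨v, hvK⟩ Set.univ (affineSpan_mono ℝ ?_ h1)
  intro z hz
  refine ⟨⟨z, hF hz⟩, ⟨trivial, fun h => hvF ?_⟩, rfl⟩
  obtain rfl : z = v := congrArg Subtype.val (Set.mem_singleton_iff.1 h)
  exact hz

theorem outward_ne_zero {K : T.Elem} {F : T.Face} (hF : F ∈ K.faces) : outward K F ≠ 0 := by
  obtain ⟨v, hvK, hvF, hv⟩ := Face.exists_opposite hF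
  have hF' := Elem.mem_faces.1 hF
  rw [outward_eq hF' hvK hvF hv F.pt_mem]
  refine smul_ne_zero (by positivity) fun h => ?_
  rw [Submodule.starProjection_apply_eq_zero_iff, Submodule.orthogonal_orthogonal] at h
  exact opposite_sub_notMem_dir hF' hvK hvF F.pt_mem h

theorem norm_normal {K : T.Elem} {F : T.Face} (hF : F ∈ K.faces) : ‖normal K F‖ = 1 := by
  rw [normal, norm_smul, norm_inv, norm_norm, inv_mul_cancel₀ (norm_ne_zero_iff.2 (outward_ne_zero hF))]

/-- A vector paired with its orthogonal projection gives the squared norm of the projection. This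
sign is what makes `normal` point out of `K`. -/
theorem inner_normal_pos {K : T.Elem} {F : T.Face} {v : E d} (hF : F ∈ K.faces)
    (hvK : v ∈ K.1) (hvF : v ∉ F.1) (hv : ∀ y ∈ K.1, y ≠ v → y ∈ F.1) {y : E d} (hy : y ∈ F.1) :
    0 < inner ℝ (y - v) (normal K F) := by
  have h0 := outward_ne_zero hF
  rw [outward_eq (Elem.mem_faces.1 hF) hvK hvF hv hy] at h0
  have h1 : F.dirᗮ.starProjection (y - v) ≠ 0 := fun h => h0 (by rw [h, smul_zero])
  have h2 : inner ℝ (y - v) (F.dirᗮ.starProjection (y - v)) =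
      ‖F.dirᗮ.starProjection (y - v)‖ ^ 2 := by
    have h3 := Submodule.starProjection_inner_eq_zero (K := F.dirᗮ) (y - v) _
      (Submodule.starProjection_apply_mem F.dirᗮ (y - v))
    rw [inner_sub_left, sub_eq_zero] at h3
    rw [h3, real_inner_self_eq_norm_sq]
  rw [normal, inner_smul_right, outward_eq (Elem.mem_faces.1 hF) hvK hvF hv hy, inner_smul_right, h2]
  have h4 : 0 < ‖F.dirᗮ.starProjection (y - v)‖ := norm_pos_iff.2 h1
  have h5 : 0 < ‖((d : ℝ) + 1)⁻¹‖ := norm_pos_iff.2 (by positivity)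
  rw [norm_smul]
  exact mul_pos (inv_pos.2 (mul_pos h5 h4)) (mul_pos (by positivity) (pow_pos h4 2))

theorem Face.finrank_orthogonal (F : T.Face) : Module.finrank ℝ F.dirᗮ = 1 := by
  have h := F.dir.finrank_add_finrank_orthogonal
  have h1 := F.finrank_dir
  have h2 := F.one_le_dim
  simp only [finrank_euclideanSpace, Fintype.card_fin] at h
  omega

/-! ### Faces and barycentric coordinates -/

open Classical in
/-- The face of an element opposite to a vertex. -/
noncomputable def Elem.facet (hd : 1 ≤ d) (K : T.Elem) (i : K.1) : T.Face :=
  ⟨K.1.erase i.1, T.cx.down_closed K.2.1 (Finset.erase_subset _ _) (by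
    rw [← Finset.card_pos, Finset.card_erase_of_mem i.2, K.2.2]; omega), by
    rw [Finset.card_erase_of_mem i.2, K.2.2]; rfl⟩

section facet
variable {hd : 1 ≤ d} {K : T.Elem}

theorem Elem.mem_facet {i : K.1} {y : E d} : y ∈ (K.facet hd i).1 ↔ y ≠ i.1 ∧ y ∈ K.1 := by
  simp [Elem.facet]

theorem Elem.facet_mem_faces (i : K.1) : K.facet hd i ∈ K.faces :=
  Elem.mem_faces.2 fun _ hy => (Elem.mem_facet.1 hy).2

theorem Elem.sum_faces (f : T.Face → ℝ) :
    ∑ F ∈ K.faces, f F = ∑ i : K.1, f (K.facet hd i) := by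
  symm
  refine Finset.sum_bij (fun i _ => K.facet hd i) (fun i _ => Elem.facet_mem_faces i)
    (fun i _ j _ h => ?_) (fun F hF => ?_) (fun _ _ => rfl)
  · by_contra hij
    have h1 : i.1 ∈ (K.facet hd j).1 := Elem.mem_facet.2 ⟨fun h => hij (Subtype.ext h), i.2⟩
    rw [← h] at h1
    exact (Elem.mem_facet.1 h1).1 rfl
  · obtain ⟨v, hvK, hvF, hv⟩ := Face.exists_opposite hF
    refine ⟨⟨v, hvK⟩, Finset.mem_univ _, Subtype.ext ?_⟩
    ext y
    rw [Elem.mem_facet]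
    constructor
    · exact fun h => hv y h.2 h.1
    · exact fun h => ⟨fun h' => hvF (by subst h'; exact h), Elem.mem_faces.1 hF h⟩

theorem Elem.coord_param {i : K.1} (z : (K.facet hd i).dir) :
    K.basis.coord i ((K.facet hd i).param z) = 0 := by
  have h1 : (K.facet hd i).param z ∈ affineSpan ℝ ((K.facet hd i).1 : Set (E d)) := by
    rw [← SetLike.mem_coe, ← Face.range_param]; exact ⟨z, rfl⟩
  have h2 : ((K.facet hd i).1 : Set (E d)) ⊆
      (AffineSubspace.comap (K.basis.coord i) (AffineSubspace.mk' (0 : ℝ) ⊥) : Set (E d)) := by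
    intro y hy
    obtain ⟨h3, h4⟩ := Elem.mem_facet.1 hy
    have h5 := K.basis.coord_apply_ne (i := i) (j := ⟨y, h4⟩) (fun h => h3 (h ▸ rfl))
    simp only [Elem.basis_apply] at h5
    simp [h5]
  simpa using affineSpan_le.2 h2 h1

theorem Elem.mem_facet_set {i : K.1} {x : E d} :
    x ∈ (K.facet hd i).set ↔ (∀ l, 0 ≤ K.basis.coord l x) ∧ K.basis.coord i x = 0 := by
  constructor
  · intro hx
    have h1 := Face.set_subset_elem (Elem.facet_mem_faces i) hx
    rw [K.set_eq] at h1
    obtain ⟨z, rfl⟩ := Face.set_subset_range _ hx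
    exact ⟨h1, Elem.coord_param z⟩
  · rintro ⟨h1, h2⟩
    rw [← K.basis.linear_combination_coord_eq_self x, ← finsum_eq_sum_of_fintype]
    refine (convex_convexHull ℝ _).finsum_mem h1 ?_ fun l hl => ?_
    · rw [finsum_eq_sum_of_fintype, K.basis.sum_coord_apply_eq_one]
    · refine subset_convexHull ℝ _ (Elem.mem_facet.2 ⟨fun h => hl ?_, l.2⟩)
      rw [Subtype.ext h]; exact h2

theorem Elem.mem_facet_dom {i : K.1} {z : (K.facet hd i).dir} :
    z ∈ (K.facet hd i).dom ↔ ∀ l, 0 ≤ K.basis.coord l ((K.facet hd i).param z) := by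
  rw [Face.dom, Set.mem_preimage, Elem.mem_facet_set]
  exact and_iff_left (Elem.coord_param z)

theorem Elem.coord_add_smul (l i j : K.1) (x : E d) (t : ℝ) :
    K.basis.coord l (x + t • (j.1 - i.1)) =
      K.basis.coord l x + t * (K.basis.coord l j.1 - K.basis.coord l i.1) := by
  have h1 : x + t • (j.1 - i.1) = (t • (j.1 - i.1)) +ᵥ x := by simp [add_comm]
  have h2 : K.basis.coord l j.1 - K.basis.coord l i.1 = (K.basis.coord l).linear (j.1 - i.1) := by
    rw [← vsub_eq_sub j.1 i.1, AffineMap.linearMap_vsub]; simp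
  rw [h1, AffineMap.map_vadd, map_smul, h2]
  simp [add_comm]

theorem Elem.coord_vertex_self (i : K.1) : K.basis.coord i i.1 = 1 := K.basis.coord_apply_eq i

theorem Elem.coord_vertex_ne {i j : K.1} (h : i ≠ j) : K.basis.coord i j.1 = 0 :=
  K.basis.coord_apply_ne h

theorem Elem.continuous_coord (i : K.1) : Continuous (K.basis.coord i) :=
  (K.basis.coord i).continuous_of_finiteDimensional

/-- Moving along the edge from `i` to `j` changes only the barycentric coordinates `i` and `j`, and
keeps their sum. Hence `Aj` and `Ai` are, up to their bases, half-cylinders in that direction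
starting from the facets opposite `j` and `i`. They are nested, and `K` is `Aj` minus `Ai`. -/
theorem Elem.setIntegral_fderiv_edge {i j : K.1} (hij : i ≠ j) {Φ : E d → ℝ}
    (hΦ : ContDiff ℝ 1 Φ) (hc : HasCompactSupport Φ) :
    ∫ x in K.set, fderiv ℝ Φ x (j.1 - i.1) =
      inner ℝ (j.1 - i.1) (normal K (K.facet hd i)) * ∫ x : (K.facet hd i).set, Φ x.1 ∂(K.facet hd i).surf +
      inner ℝ (j.1 - i.1) (normal K (K.facet hd j)) * ∫ x : (K.facet hd j).set, Φ x.1 ∂(K.facet hd j).surf := by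
  let C : Set (E d) := {x | (∀ l, l ≠ i → l ≠ j → 0 ≤ K.basis.coord l x) ∧
    0 ≤ K.basis.coord i x + K.basis.coord j x}
  let Ai : Set (E d) := C ∩ {x | K.basis.coord i x < 0}
  let Aj : Set (E d) := C ∩ {x | 0 ≤ K.basis.coord j x}
  have hcc := fun l => K.continuous_coord l
  have hC : MeasurableSet C := by
    have h1 : {x | ∀ l, l ≠ i → l ≠ j → 0 ≤ K.basis.coord l x} =
        ⋂ (l) (_ : l ≠ i) (_ : l ≠ j), {x | 0 ≤ K.basis.coord l x} := by
      ext x; simp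
    have h2 : IsClosed {x | ∀ l, l ≠ i → l ≠ j → 0 ≤ K.basis.coord l x} := by
      rw [h1]
      exact isClosed_iInter fun l => isClosed_iInter fun _ => isClosed_iInter fun _ =>
        isClosed_le continuous_const (hcc l)
    exact (h2.inter (isClosed_le continuous_const ((hcc i).add (hcc j)))).measurableSet
  have hAi : MeasurableSet Ai := hC.inter (isOpen_lt (hcc i) continuous_const).measurableSet
  have hAj : MeasurableSet Aj := hC.inter (isClosed_le continuous_const (hcc j)).measurableSet
  have hji := hij.symm
  have cjj := K.coord_vertex_self j
  have cii := K.coord_vertex_self i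
  have cij := K.coord_vertex_ne hij
  have cji := K.coord_vertex_ne hji
  have hI : ∫ x in Ai, fderiv ℝ Φ x (j.1 - i.1) =
      -(inner ℝ (j.1 - i.1) (normal K (K.facet hd i)) *
        ∫ x : (K.facet hd i).set, Φ x.1 ∂(K.facet hd i).surf) := by
    have hmem := K.facet_mem_faces (hd := hd) i
    rw [Face.integral_surf]
    simp only [Face.param_apply]
    refine setIntegral_fderiv_halfCylinder (K.facet hd i).dir (K.facet hd i).finrank_orthogonal
      (K.facet hd i).pt (normal_mem_orthogonal _ _) (norm_normal hmem)
      (inner_normal_pos hmem i.2 (fun h => (Elem.mem_facet.1 h).1 rfl)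
        (fun y hy hyi => Elem.mem_facet.2 ⟨hyi, hy⟩)
        (Elem.mem_facet.2 ⟨fun h => hji (Subtype.ext h), j.2⟩))
      hAi (K.facet hd i).measurableSet_dom (fun z t _ => ?_) hΦ hc
    rw [← Face.param_apply, Elem.mem_facet_dom]
    have hz := Elem.coord_param z
    simp only [Ai, C, Set.mem_inter_iff, Set.mem_ofPred_eq, Elem.coord_add_smul, cii, cjj, cij, cji,
      hz]
    constructor
    · rintro ⟨⟨h1, h2⟩, h3⟩
      refine ⟨fun l => ?_, by linarith⟩
      by_cases hli : l = i
      · rw [hli, hz]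
      · by_cases hlj : l = j
        · rw [hlj]; linarith
        · simpa [K.coord_vertex_ne hli, K.coord_vertex_ne hlj] using h1 l hli hlj
    · rintro ⟨h1, h2⟩
      refine ⟨⟨fun l hli hlj => ?_, ?_⟩, by linarith⟩
      · simpa [K.coord_vertex_ne hli, K.coord_vertex_ne hlj] using h1 l
      · linarith [h1 j]
  have hJ : ∫ x in Aj, fderiv ℝ Φ x (j.1 - i.1) =
      inner ℝ (j.1 - i.1) (normal K (K.facet hd j)) *
        ∫ x : (K.facet hd j).set, Φ x.1 ∂(K.facet hd j).surf := by
    have hmem := K.facet_mem_faces (hd := hd) j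
    rw [Face.integral_surf]
    simp only [Face.param_apply]
    have hin : inner ℝ (j.1 - i.1) (-normal K (K.facet hd j)) =
        inner ℝ (i.1 - j.1) (normal K (K.facet hd j)) := by
      rw [← neg_sub i.1 j.1, inner_neg_neg]
    -- On the facet opposite `j` the edge direction points into `K`, so the inward normal plays the
    -- role of `m`.
    rw [setIntegral_fderiv_halfCylinder (K.facet hd j).dir (K.facet hd j).finrank_orthogonal
      (K.facet hd j).pt (m := -normal K (K.facet hd j)) (Submodule.neg_mem _ (normal_mem_orthogonal _ _))
      (by rw [norm_neg, norm_normal hmem])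
      (by
        rw [hin]
        exact inner_normal_pos hmem j.2 (fun h => (Elem.mem_facet.1 h).1 rfl)
          (fun y hy hyi => Elem.mem_facet.2 ⟨hyi, hy⟩)
          (Elem.mem_facet.2 ⟨fun h => hij (Subtype.ext h), i.2⟩))
      hAj (K.facet hd j).measurableSet_dom (fun z t ht => ?_) hΦ hc]
    · rw [inner_neg_right]; ring
    rw [← Face.param_apply, Elem.mem_facet_dom]
    have hz := Elem.coord_param z
    simp only [Aj, C, Set.mem_inter_iff, Set.mem_ofPred_eq, Elem.coord_add_smul, cii, cjj, cij, cji,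
      hz]
    constructor
    · rintro ⟨⟨h1, h2⟩, h3⟩
      refine ⟨fun l => ?_, lt_of_le_of_ne (by linarith) (Ne.symm ht)⟩
      by_cases hlj : l = j
      · rw [hlj, hz]
      · by_cases hli : l = i
        · rw [hli]; linarith
        · simpa [K.coord_vertex_ne hli, K.coord_vertex_ne hlj] using h1 l hli hlj
    · rintro ⟨h1, h2⟩
      refine ⟨⟨fun l hli hlj => ?_, ?_⟩, by linarith⟩
      · simpa [K.coord_vertex_ne hli, K.coord_vertex_ne hlj] using h1 l
      · linarith [h1 i]
  have hsub : Ai ⊆ Aj := by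
    rintro x ⟨⟨h1, h2⟩, h3⟩
    refine ⟨⟨h1, h2⟩, ?_⟩
    simp only [Set.mem_ofPred_eq] at h3 ⊢
    linarith
  have hK : K.set = Aj \ Ai := by
    rw [K.set_eq]
    ext x
    simp only [Ai, Aj, C, Set.mem_sdiff, Set.mem_inter_iff, Set.mem_ofPred_eq]
    constructor
    · intro h
      exact ⟨⟨⟨fun l _ _ => h l, add_nonneg (h i) (h j)⟩, h j⟩, fun h' => not_lt.2 (h i) h'.2⟩
    · rintro ⟨⟨hC', hj⟩, h2⟩ l
      by_cases hli : l = i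
      · rw [hli]; by_contra hlt; exact h2 ⟨hC', not_le.1 hlt⟩
      · by_cases hlj : l = j
        · rw [hlj]; exact hj
        · exact hC'.1 l hli hlj
  have hcont : Continuous fun x => fderiv ℝ Φ x (j.1 - i.1) :=
    (hΦ.continuous_fderiv one_ne_zero).clm_apply continuous_const
  have hint : Integrable (fun x => fderiv ℝ Φ x (j.1 - i.1)) volume :=
    hcont.integrable_of_hasCompactSupport (hc.fderiv_apply ℝ _)
  rw [hK, setIntegral_sdiff hAi hint.integrableOn hsub, hI, hJ]
  ring

/-- Both sides are linear in `e`, and the edges from one vertex span the space. For such an edge,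
every facet that contains both end points has a normal orthogonal to it, so only the two facets of
the edge formula contribute. -/
theorem Elem.setIntegral_fderiv_of_hasCompactSupport (hd : 1 ≤ d) (K : T.Elem) {Φ : E d → ℝ}
    (hΦ : ContDiff ℝ 1 Φ) (hc : HasCompactSupport Φ) (e : E d) :
    ∫ x in K.set, fderiv ℝ Φ x e =
      ∑ F ∈ K.faces, inner ℝ e (normal K F) * ∫ x : F.set, Φ x.1 ∂F.surf := by
  have hcont : ∀ e, Continuous fun x => fderiv ℝ Φ x e := fun e =>
    (hΦ.continuous_fderiv one_ne_zero).clm_apply continuous_const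
  have hint : ∀ e, IntegrableOn (fun x => fderiv ℝ Φ x e) K.set volume := fun e =>
    (hcont e).continuousOn.integrableOn_compact K.isCompact_set
  obtain ⟨i₀⟩ : Nonempty K.1 := K.basis.nonempty
  have hspan : e ∈ Submodule.span ℝ ((· -ᵥ i₀.1) '' (K.1 : Set (E d))) := by
    rw [← vectorSpan_eq_span_vsub_set_right ℝ (Finset.mem_coe.2 i₀.2), ← direction_affineSpan,
      ← K.range_basis, K.basis.tot, AffineSubspace.direction_top]
    trivial
  induction hspan using Submodule.span_induction with
  | mem e he =>
    obtain ⟨y, hy, rfl⟩ := he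
    by_cases hyi : y = i₀.1
    · simp [hyi]
    have hne : i₀ ≠ ⟨y, hy⟩ := fun h => hyi (congrArg Subtype.val h).symm
    rw [K.sum_faces (hd := hd), Finset.sum_eq_add i₀ ⟨y, hy⟩ hne]
    · exact K.setIntegral_fderiv_edge hne hΦ hc
    · rintro l - ⟨hl1, hl2⟩
      have h1 : y - i₀.1 ∈ (K.facet hd l).dir := vsub_mem_vectorSpan ℝ
        (Finset.mem_coe.2 (Elem.mem_facet.2 ⟨fun h => hl2 (Subtype.ext h.symm), hy⟩))
        (Finset.mem_coe.2 (Elem.mem_facet.2 ⟨fun h => hl1 (Subtype.ext h.symm), i₀.2⟩))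
      have h2 := (Submodule.mem_orthogonal _ _).1 (normal_mem_orthogonal K _) _ h1
      exact mul_eq_zero_of_left h2 _
    · simp
    · simp
  | zero => simp
  | add x y _ _ hx hy =>
    simp only [map_add, inner_add_left, add_mul, Finset.sum_add_distrib]
    rw [integral_add (hint x) (hint y), hx, hy]
  | smul a x _ hx =>
    simp only [map_smul, smul_eq_mul, inner_smul_left, mul_assoc]
    rw [integral_const_mul, hx, Finset.mul_sum]
    rfl

/-- The Gauss theorem on a simplex. -/
theorem Elem.setIntegral_fderiv (hd : 1 ≤ d) (K : T.Elem) {Φ : E d → ℝ}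
    (hΦ : ContDiff ℝ 1 Φ) (e : E d) :
    ∫ x in K.set, fderiv ℝ Φ x e =
      ∑ F ∈ K.faces, inner ℝ e (normal K F) * ∫ x : F.set, Φ x.1 ∂F.surf := by
  obtain ⟨R, hR⟩ := K.isCompact_set.isBounded.subset_ball (0 : E d)
  -- A cutoff equal to one near `K` changes neither side. The maximum with one keeps the inner
  -- radius positive.
  let χ : ContDiffBump (0 : E d) := ⟨max R 1, max R 1 + 1, by positivity, by linarith⟩
  have hχ : ∀ x ∈ K.set, ∀ᶠ y in nhds x, χ y = 1 := fun x hx =>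
    χ.eventuallyEq_one_of_mem_ball (Metric.ball_subset_ball (le_max_left _ _) (hR hx))
  have h := K.setIntegral_fderiv_of_hasCompactSupport hd (Φ := fun x => χ x * Φ x)
    (χ.contDiff.mul hΦ) χ.hasCompactSupport.mul_right e
  have h1 : ∫ x in K.set, fderiv ℝ (fun x => χ x * Φ x) x e = ∫ x in K.set, fderiv ℝ Φ x e := by
    refine setIntegral_congr_fun K.measurableSet_set fun x hx => ?_
    have : (fun x => χ x * Φ x) =ᶠ[nhds x] Φ := (hχ x hx).mono fun y hy => by simp [hy]
    simp only [this.fderiv_eq]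
  rw [h1] at h
  rw [h]
  refine Finset.sum_congr rfl fun F hF => ?_
  congr 2
  ext x
  simp [(hχ _ (Face.set_subset_elem hF x.2)).self_of_nhds]

end facet
end Mesh
open Mesh

/-! ### Polynomials as smooth and analytic functions. -/

section PolynomialFunctions
variable {d : ℕ}

@[simp] theorem ev_zero (x : E d) : ev (0 : Pol d) x = 0 := by simp [ev]
@[simp] theorem ev_add (p q : Pol d) (x : E d) : ev (p + q) x = ev p x + ev q x := by simp [ev]
@[simp] theorem ev_mul (p q : Pol d) (x : E d) : ev (p * q) x = ev p x * ev q x := by simp [ev]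
@[simp] theorem ev_smul (c : ℝ) (p : Pol d) (x : E d) : ev (c • p) x = c * ev p x := by simp [ev]
@[simp] theorem ev_C (c : ℝ) (x : E d) : ev (MvPolynomial.C c : Pol d) x = c := by simp [ev]
@[simp] theorem ev_X (i : Fin d) (x : E d) : ev (MvPolynomial.X i : Pol d) x = x i := by simp [ev]

theorem ev_sum {ι : Type*} (s : Finset ι) (p : ι → Pol d) (x : E d) :
    ev (∑ i ∈ s, p i) x = ∑ i ∈ s, ev (p i) x := by simp [ev]

@[simp] theorem vev_zero (x : E d) : vev (0 : VPol d) x = 0 := by ext i; simp [vev]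
@[simp] theorem vev_add (p q : VPol d) (x : E d) : vev (p + q) x = vev p x + vev q x := by
  ext i; simp [vev]
@[simp] theorem vev_smul (c : ℝ) (p : VPol d) (x : E d) : vev (c • p) x = c • vev p x := by
  ext i; simp [vev]

@[simp] theorem pdiv_zero : pdiv (0 : VPol d) = 0 := by simp [pdiv]
theorem pdiv_add (v w : VPol d) : pdiv (v + w) = pdiv v + pdiv w := by
  simp [pdiv, Finset.sum_add_distrib]
theorem pdiv_smul (c : ℝ) (v : VPol d) : pdiv (c • v) = c • pdiv v := by
  simp [pdiv, Finset.smul_sum]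

theorem contDiff_ev (p : Pol d) {n : WithTop ℕ∞} : ContDiff ℝ n (ev p) := by
  induction p using MvPolynomial.induction_on with
  | C a =>
    have h : ev (MvPolynomial.C a : Pol d) = fun _ => a := funext fun x => ev_C a x
    exact h ▸ contDiff_const
  | add p q hp hq =>
    have h : ev (p + q) = ev p + ev q := funext fun x => ev_add p q x
    exact h ▸ hp.add hq
  | mul_X p i hp =>
    have h : ev (p * MvPolynomial.X i) = ev p * fun x => x i := funext fun x => by simp
    have h' : ContDiff ℝ n fun x : E d => x i := by fun_prop
    exact h ▸ hp.mul h'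

@[fun_prop] theorem continuous_ev (p : Pol d) : Continuous (ev p) :=
  (contDiff_ev p (n := 0)).continuous

@[fun_prop] theorem continuous_vev (v : VPol d) : Continuous (vev v) :=
  continuous_pi fun i => continuous_ev (v i)

theorem fderiv_ev (p : Pol d) (x e : E d) :
    fderiv ℝ (ev p) x e = ∑ i, e i * ev (MvPolynomial.pderiv i p) x := by
  induction p using MvPolynomial.induction_on with
  | C a =>
    have h : ev (MvPolynomial.C a : Pol d) = fun _ => a := funext fun x => ev_C a x
    rw [h]; simp
  | add p q hp hq =>
    have h : ev (p + q) = ev p + ev q := funext fun x => ev_add p q x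
    have hp' := (contDiff_ev p (n := 1)).differentiable one_ne_zero x
    have hq' := (contDiff_ev q (n := 1)).differentiable one_ne_zero x
    rw [h, fderiv_add hp' hq']
    simp [hp, hq, mul_add, Finset.sum_add_distrib]
  | mul_X p j hp =>
    have h : ev (p * MvPolynomial.X j) = ev p * fun x => x j := funext fun x => by simp
    have hp' := (contDiff_ev p (n := 1)).differentiable one_ne_zero x
    have hj : HasFDerivAt (fun x : E d => x j) (EuclideanSpace.proj j : E d →L[ℝ] ℝ) x :=
      (EuclideanSpace.proj j : E d →L[ℝ] ℝ).hasFDerivAt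
    rw [h, fderiv_mul hp' hj.differentiableAt, hj.fderiv]
    simp only [add_apply, smul_apply, hp,
      MvPolynomial.pderiv_mul, ev_add, ev_mul, ev_X, smul_eq_mul, mul_add, Finset.sum_add_distrib,
      MvPolynomial.pderiv_X, PiLp.proj_apply]
    rw [Finset.mul_sum, add_comm]
    congr 1
    · exact Finset.sum_congr rfl fun i _ => by ring
    · rw [Finset.sum_eq_single j]
      · simp [ev]; ring
      · intro i _ hij
        simp [hij.symm, ev]
      · simp

theorem analyticOnNhd_ev (p : Pol d) : AnalyticOnNhd ℝ (ev p) Set.univ := by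
  have h := AnalyticOnNhd.aeval_mvPolynomial (𝕜 := ℝ) (f := fun (x : E d) i => x i) (s := Set.univ)
    (fun i => (EuclideanSpace.proj i : E d →L[ℝ] ℝ).analyticOnNhd _) p
  exact h.congr isOpen_univ fun x _ => by simp [ev, MvPolynomial.aeval_eq_eval]

/-- Analytic continuation from a ball. It makes the `L²(K)` form definite on polynomials as formal
objects, not only on their restrictions to `K`. -/
theorem eq_zero_of_ev_eq_zero {U : Set (E d)} (hU : (interior U).Nonempty) {p : Pol d}
    (h : ∀ x ∈ U, ev p x = 0) : p = 0 := by
  obtain ⟨x, hx⟩ := hU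
  have h1 : ev p =ᶠ[nhds x] 0 := by
    filter_upwards [isOpen_interior.mem_nhds hx] with y hy
    exact h y (interior_subset hy)
  have h2 := (analyticOnNhd_ev p).eqOn_zero_of_preconnected_of_eventuallyEq_zero
    isPreconnected_univ (Set.mem_univ x) h1
  refine MvPolynomial.funext fun y => ?_
  have := h2 (Set.mem_univ (WithLp.toLp 2 y))
  simpa [ev] using this

end PolynomialFunctions

/-! ### Integration by parts on an element. -/

section Incidence
variable {d : ℕ} {Ω : Set (E d)} {T : Mesh d Ω}

theorem Mesh.Face.integrable_surf (F : T.Face) {g : F.set → ℝ} (hg : Continuous g) :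
    Integrable g F.surf :=
  hg.integrable_of_hasCompactSupport (HasCompactSupport.of_compactSpace g)

theorem Mesh.Face.integrable_mul (F : T.Face) {m g : F.set → ℝ} (hm : Integrable m F.surf)
    (hg : Continuous g) : Integrable (fun x => m x * g x) F.surf := by
  rw [← integrableOn_univ] at hm ⊢
  exact hm.mul_continuousOn hg.continuousOn isCompact_univ

theorem Mesh.Elem.integrable_of_continuous (K : T.Elem) {g : E d → ℝ} (hg : Continuous g) :
    IntegrableOn g K.set volume :=
  hg.continuousOn.integrableOn_compact K.isCompact_set

theorem Mesh.Elem.integrable_mul (K : T.Elem) {m g : E d → ℝ} (hm : IntegrableOn m K.set volume)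
    (hg : Continuous g) : IntegrableOn (fun x => m x * g x) K.set volume :=
  hm.mul_continuousOn hg.continuousOn K.isCompact_set

/-- Integration by parts on an element. -/
theorem Mesh.Elem.integral_by_parts (hd : 1 ≤ d) (K : T.Elem) (v : VPol d) {φ : E d → ℝ}
    (hφ : ContDiff ℝ 1 φ) :
    (∫ x in K.set, vev v x ⬝ᵥ fun i => fderiv ℝ φ x (EuclideanSpace.single i 1)) +
      ∫ x in K.set, φ x * ev (pdiv v) x =
    ∑ F ∈ K.faces, ∫ x : F.set, φ x.1 * (vev v x.1 ⬝ᵥ fun i => normal K F i) ∂F.surf := by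
  have hint : ∀ {f : E d → ℝ}, Continuous f → IntegrableOn f K.set volume :=
    K.integrable_of_continuous
  have hφc := hφ.continuous
  have hφ' : ∀ i : Fin d, Continuous fun x => fderiv ℝ φ x (EuclideanSpace.single i 1) := fun i =>
    (hφ.continuous_fderiv one_ne_zero).clm_apply continuous_const
  -- The Gauss theorem for `φ v_i` in the `i`-th coordinate direction; the sum over `i` is the
  -- claim.
  have h : ∀ i, ∫ x in K.set, (ev (v i) x * fderiv ℝ φ x (EuclideanSpace.single i 1) +
      φ x * ev (MvPolynomial.pderiv i (v i)) x) =
      ∑ F ∈ K.faces, ∫ x : F.set, φ x.1 * (ev (v i) x.1 * normal K F i) ∂F.surf := by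
    intro i
    have h1 := K.setIntegral_fderiv hd (Φ := φ * ev (v i)) (hφ.mul (contDiff_ev _))
      (EuclideanSpace.single i 1)
    rw [← setIntegral_congr_fun K.measurableSet_set (fun x _ => ?_), h1]
    · refine Finset.sum_congr rfl fun F _ => ?_
      rw [← integral_const_mul]
      congr 1
      ext x
      simp [EuclideanSpace.inner_single_left]
      ring
    · rw [fderiv_mul (hφ.differentiable one_ne_zero _)
        ((contDiff_ev (v i) (n := 1)).differentiable one_ne_zero _)]
      simp only [add_apply, smul_apply, fderiv_ev,
        smul_eq_mul]
      rw [Finset.sum_eq_single i]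
      · simp; ring
      · intro j _ hj; simp [hj]
      · simp
  rw [← integral_add (hint (by unfold dotProduct; fun_prop)) (hint (by fun_prop))]
  have h2 : ∀ x, (vev v x ⬝ᵥ fun i => fderiv ℝ φ x (EuclideanSpace.single i 1)) +
      φ x * ev (pdiv v) x = ∑ i, (ev (v i) x * fderiv ℝ φ x (EuclideanSpace.single i 1) +
      φ x * ev (MvPolynomial.pderiv i (v i)) x) := by
    intro x
    rw [pdiv, ev_sum, Finset.sum_add_distrib, Finset.mul_sum]
    rfl
  simp only [h2]
  rw [integral_finsetSum _ fun i _ => hint (by fun_prop)]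
  simp only [h]
  rw [Finset.sum_comm]
  refine Finset.sum_congr rfl fun F _ => ?_
  rw [← integral_finsetSum]
  · congr 1
    ext x
    rw [← Finset.mul_sum]
    rfl
  · intro i _
    exact F.integrable_surf (by fun_prop)

end Incidence

/-! ### Finite-dimensional duality and localization of tests. -/

theorem existsUnique_riesz {V : Type*} [AddCommGroup V] [Module ℝ V] [FiniteDimensional ℝ V]
    (B : V →ₗ[ℝ] V →ₗ[ℝ] ℝ) (hB : ∀ v, B v v = 0 → v = 0) (ℓ : V →ₗ[ℝ] ℝ) :
    ∃! g, ∀ r, B g r = ℓ r := by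
  have hinj : Function.Injective B := by
    rw [injective_iff_map_eq_zero]
    intro v hv
    exact hB v (by rw [hv]; rfl)
  -- `V` and its dual have the same dimension, so injectivity suffices; symmetry of `B` plays no
  -- role.
  have hsurj : Function.Surjective B :=
    (LinearMap.injective_iff_surjective_of_finrank_eq_finrank
      (Subspace.dual_finrank_eq (K := ℝ) (V := V)).symm).1 hinj
  obtain ⟨g, hg⟩ := hsurj ℓ
  refine ⟨g, fun r => by rw [hg], fun g' hg' => hinj ?_⟩
  ext r
  rw [hg' r, hg]

/-- Tests supported at a single index isolate its summand. This localizes equations on `V_h` to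
elements and boundary conditions on `M_h` to faces. -/
theorem pi_sum_eq_iff {ι : Type*} {V : ι → Type*} [∀ i, Zero (V i)] (s : Finset ι)
    {φ ψ : ∀ i, V i → ℝ} (hφ : ∀ i, φ i 0 = 0) (hψ : ∀ i, ψ i 0 = 0) :
    (∀ v : ∀ i, V i, ∑ i ∈ s, φ i (v i) = ∑ i ∈ s, ψ i (v i)) ↔ ∀ i ∈ s, ∀ r, φ i r = ψ i r := by
  classical
  constructor
  · intro h i hi r
    have h1 := h (Pi.single i r)
    rw [Finset.sum_eq_single i, Finset.sum_eq_single i] at h1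
    · simpa using h1
    · intro j _ hj; rw [Pi.single_eq_of_ne hj, hψ]
    · intro h; exact absurd hi h
    · intro j _ hj; rw [Pi.single_eq_of_ne hj, hφ]
    · intro h; exact absurd hi h
  · intro h v
    exact Finset.sum_congr rfl fun i hi => h i hi _

/-! ### The maps `G`, `Q` and the discrete weak gradient. -/

section Local
variable {d : ℕ} {Ω : Set (E d)} {T : Mesh d Ω}

@[fun_prop] theorem continuous_vev_dot (v w : VPol d) : Continuous fun x => vev v x ⬝ᵥ vev w x := by
  unfold dotProduct; fun_prop

@[fun_prop] theorem continuous_vev_dot_const (v : VPol d) (n : Fin d → ℝ) :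
    Continuous fun x => vev v x ⬝ᵥ n := by
  unfold dotProduct; fun_prop

/-- The `L²(K)` inner product on polynomial vector fields. -/
noncomputable def locV (K : T.Elem) : VPol d →ₗ[ℝ] VPol d →ₗ[ℝ] ℝ :=
  LinearMap.mk₂ ℝ (fun g v => ∫ x in K.set, vev g x ⬝ᵥ vev v x)
    (fun g g' v => by
      simp only [vev_add, add_dotProduct]
      exact integral_add (K.integrable_of_continuous (by fun_prop))
        (K.integrable_of_continuous (by fun_prop)))
    (fun c g v => by
      simp only [vev_smul, smul_dotProduct, smul_eq_mul]
      exact integral_const_mul _ _)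
    (fun g v v' => by
      simp only [vev_add, dotProduct_add]
      exact integral_add (K.integrable_of_continuous (by fun_prop))
        (K.integrable_of_continuous (by fun_prop)))
    (fun c g v => by
      simp only [vev_smul, dotProduct_smul, smul_eq_mul]
      exact integral_const_mul _ _)

theorem locV_apply (K : T.Elem) (g v : VPol d) :
    locV K g v = ∫ x in K.set, vev g x ⬝ᵥ vev v x := rfl

theorem eq_zero_of_locV_self {K : T.Elem} {v : VPol d} (h : locV K v v = 0) : v = 0 := by
  have hint : ∀ i, IntegrableOn (fun x => ev (v i) x * ev (v i) x) K.set volume := fun i =>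
    K.integrable_of_continuous (by fun_prop)
  rw [locV_apply] at h
  simp only [dotProduct, vev] at h
  rw [integral_finsetSum _ fun i _ => hint i, Finset.sum_eq_zero_iff_of_nonneg
    fun i _ => integral_nonneg fun x => mul_self_nonneg _] at h
  funext i
  refine eq_zero_of_ev_eq_zero K.interior_nonempty ?_
  exact K.convex_set.eqOn_zero_of_setIntegral_sq_eq_zero volume K.isCompact_set
    K.interior_nonempty (continuous_ev _) (h i (Finset.mem_univ i))

variable {a : E d → Matrix (Fin d) (Fin d) ℝ}

theorem integrable_coeff (ha : ∀ i j, MemLp (fun x => a x i j) ⊤ (volume.restrict Ω)) (K : T.Elem)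
    (g v : VPol d) : IntegrableOn (fun x => (a x).mulVec (vev g x) ⬝ᵥ vev v x) K.set volume := by
  have h : ∀ x, (a x).mulVec (vev g x) ⬝ᵥ vev v x =
      ∑ i, ∑ j, a x i j * (ev (g j) x * ev (v i) x) := by
    intro x
    simp only [dotProduct, Matrix.mulVec, vev, Finset.sum_mul, mul_assoc]
  simp only [h]
  refine integrable_finsetSum _ fun i _ => integrable_finsetSum _ fun j _ => ?_
  refine K.integrable_mul ?_ (by fun_prop)
  exact ((ha i j).mono_measure K.restrict_le).integrable le_top

/-- The form `(a g, v)_K` on polynomial vector fields. -/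
noncomputable def locA (ha : ∀ i j, MemLp (fun x => a x i j) ⊤ (volume.restrict Ω)) (K : T.Elem) :
    VPol d →ₗ[ℝ] VPol d →ₗ[ℝ] ℝ :=
  LinearMap.mk₂ ℝ (fun g v => ∫ x in K.set, (a x).mulVec (vev g x) ⬝ᵥ vev v x)
    (fun g g' v => by
      simp only [vev_add, Matrix.mulVec_add, add_dotProduct]
      exact integral_add (integrable_coeff ha K _ _) (integrable_coeff ha K _ _))
    (fun c g v => by
      simp only [vev_smul, Matrix.mulVec_smul, smul_dotProduct, smul_eq_mul]
      exact integral_const_mul _ _)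
    (fun g v v' => by
      simp only [vev_add, dotProduct_add]
      exact integral_add (integrable_coeff ha K _ _) (integrable_coeff ha K _ _))
    (fun c g v => by
      simp only [vev_smul, dotProduct_smul, smul_eq_mul]
      exact integral_const_mul _ _)

/-- The right-hand side of the definition of the discrete weak gradient. -/
noncomputable def weakRhs (K : T.Elem) (v0 : E d → ℝ) (vb : (F : T.Face) → F.set → ℝ) (r : VPol d) :
    ℝ :=
  -(∫ x in K.set, v0 x * ev (pdiv r) x) +
      ∑ F ∈ K.faces, ∫ x, vb F x * (vev r x.1 ⬝ᵥ fun i => Mesh.normal K F i) ∂F.surf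

variable {K : T.Elem} {v0 : E d → ℝ} {vb : (F : T.Face) → F.set → ℝ}

theorem weakRhs_add (h0 : MemLp v0 2 (volume.restrict K.set))
    (hb : ∀ F ∈ K.faces, MemLp (vb F) 2 F.surf) (r r' : VPol d) :
    weakRhs K v0 vb (r + r') = weakRhs K v0 vb r + weakRhs K v0 vb r' := by
  have h0' := h0.integrable one_le_two
  have h1 : ∫ x in K.set, v0 x * ev (pdiv (r + r')) x =
      (∫ x in K.set, v0 x * ev (pdiv r) x) + ∫ x in K.set, v0 x * ev (pdiv r') x := by
    simp only [pdiv_add, ev_add, mul_add]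
    exact integral_add (K.integrable_mul h0' (by fun_prop)) (K.integrable_mul h0' (by fun_prop))
  have h2 : ∀ F ∈ K.faces, ∫ x, vb F x * (vev (r + r') x.1 ⬝ᵥ fun i => Mesh.normal K F i) ∂F.surf =
      (∫ x, vb F x * (vev r x.1 ⬝ᵥ fun i => Mesh.normal K F i) ∂F.surf) +
      ∫ x, vb F x * (vev r' x.1 ⬝ᵥ fun i => Mesh.normal K F i) ∂F.surf := by
    intro F hF
    have hb' := (hb F hF).integrable one_le_two
    simp only [vev_add, add_dotProduct, mul_add]
    exact integral_add (F.integrable_mul hb' (by fun_prop)) (F.integrable_mul hb' (by fun_prop))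
  rw [weakRhs, h1, Finset.sum_congr rfl h2, Finset.sum_add_distrib, weakRhs, weakRhs]
  ring

theorem weakRhs_smul (c : ℝ) (r : VPol d) :
    weakRhs K v0 vb (c • r) = c * weakRhs K v0 vb r := by
  simp only [weakRhs, pdiv_smul, ev_smul, vev_smul, smul_dotProduct, smul_eq_mul, mul_left_comm _ c]
  simp only [integral_const_mul]
  rw [mul_add, Finset.mul_sum]
  ring

theorem weakRhs_data {v0' : E d → ℝ} {vb' : (F : T.Face) → F.set → ℝ}
    (h0 : MemLp v0 2 (volume.restrict K.set)) (hb : ∀ F ∈ K.faces, MemLp (vb F) 2 F.surf)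
    (h0' : MemLp v0' 2 (volume.restrict K.set)) (hb' : ∀ F ∈ K.faces, MemLp (vb' F) 2 F.surf)
    (s : ℝ) (r : VPol d) :
    weakRhs K (s • v0 + v0') (s • vb + vb') r = s * weakRhs K v0 vb r + weakRhs K v0' vb' r := by
  have i0 := h0.integrable one_le_two
  have i0' := h0'.integrable one_le_two
  have h1 : ∫ x in K.set, (s • v0 + v0') x * ev (pdiv r) x =
      s * (∫ x in K.set, v0 x * ev (pdiv r) x) + ∫ x in K.set, v0' x * ev (pdiv r) x := by
    simp only [Pi.add_apply, Pi.smul_apply, smul_eq_mul, add_mul, mul_assoc]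
    rw [← integral_const_mul]
    exact integral_add ((K.integrable_mul i0 (by fun_prop)).const_mul s)
      (K.integrable_mul i0' (by fun_prop))
  have h2 : ∀ F ∈ K.faces,
      ∫ x, (s • vb + vb') F x * (vev r x.1 ⬝ᵥ fun i => Mesh.normal K F i) ∂F.surf =
      s * (∫ x, vb F x * (vev r x.1 ⬝ᵥ fun i => Mesh.normal K F i) ∂F.surf) +
      ∫ x, vb' F x * (vev r x.1 ⬝ᵥ fun i => Mesh.normal K F i) ∂F.surf := by
    intro F hF
    have ib := (hb F hF).integrable one_le_two
    have ib' := (hb' F hF).integrable one_le_two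
    simp only [Pi.add_apply, Pi.smul_apply, smul_eq_mul, add_mul, mul_assoc]
    rw [← integral_const_mul]
    exact integral_add ((F.integrable_mul ib (by fun_prop)).const_mul s)
      (F.integrable_mul ib' (by fun_prop))
  rw [weakRhs, h1, Finset.sum_congr rfl h2, Finset.sum_add_distrib, ← Finset.mul_sum, weakRhs,
    weakRhs]
  ring

variable (L : LocalSpaces T)

theorem isWeakGradient_iff (g : L.V K) :
    IsWeakGradient L K v0 vb g ↔ ∀ r : L.V K, locV K g.1 r.1 = weakRhs K v0 vb r.1 := Iff.rfl

theorem existsUnique_locV (K : T.Elem) (ℓ : L.V K →ₗ[ℝ] ℝ) :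
    ∃! g : L.V K, ∀ r : L.V K, locV K g.1 r.1 = ℓ r := by
  have := L.finV K
  exact existsUnique_riesz ((locV K).domRestrict₁₂ (L.V K) (L.V K))
    (fun v hv => Subtype.ext (eq_zero_of_locV_self hv)) ℓ

theorem existsUnique_isWeakGradient (h0 : MemLp v0 2 (volume.restrict K.set))
    (hb : ∀ F ∈ K.faces, MemLp (vb F) 2 F.surf) : ∃! g : L.V K, IsWeakGradient L K v0 vb g :=
  existsUnique_locV L K
    { toFun := fun r => weakRhs K v0 vb r.1
      map_add' := fun r r' => weakRhs_add h0 hb r.1 r'.1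
      map_smul' := fun c r => weakRhs_smul c r.1 }

/-- Up to sign, the right side of the equation for `G` is the sum over `K` of the functionals that
define the discrete weak gradients, so localization identifies the two notions. -/
theorem isG_iff (w : VolFun T) (what : BdryFun T) (G : L.Vh) :
    IsG L w what G ↔ ∀ K, IsWeakGradient L K (w K) (what K) (G K) := by
  have h : ∀ v : L.Vh, (-innerV G v = innerVol w (volDiv v) - innerBdry what (trN v)) ↔
      ∑ K, locV K (G K).1 (v K).1 = ∑ K, weakRhs K (w K) (what K) (v K).1 := by
    intro v
    have h1 : innerV G v = ∑ K, locV K (G K).1 (v K).1 := rfl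
    have h2 : innerVol w (volDiv v) - innerBdry what (trN v) =
        -∑ K, weakRhs K (w K) (what K) (v K).1 := by
      simp only [weakRhs, Finset.sum_add_distrib, Finset.sum_neg_distrib]
      rw [innerVol, innerBdry, neg_add, neg_neg]
      rfl
    rw [h1, h2, neg_inj]
  simp only [IsG, h, isWeakGradient_iff]
  rw [pi_sum_eq_iff Finset.univ (φ := fun K (r : L.V K) => locV K (G K).1 r.1)
    (ψ := fun K (r : L.V K) => weakRhs K (w K) (what K) r.1)]
  · simp
  · intro K; simp
  · intro K; simp [weakRhs]

theorem existsUnique_isG {w : VolFun T} {what : BdryFun T} (hw : MemL2Vol w)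
    (hwhat : MemL2Bdry what) : ∃! G : L.Vh, IsG L w what G := by
  simp only [isG_iff]
  choose G hG hG' using fun K => existsUnique_isWeakGradient L (K := K) (hw K) (hwhat K)
  exact ⟨G, hG, fun G' h => funext fun K => hG' K _ (h K)⟩

theorem isQ_iff (ha : ∀ i j, MemLp (fun x => a x i j) ⊤ (volume.restrict Ω)) (G Q : L.Vh) :
    IsQ L a G Q ↔ ∀ K, ∀ r : L.V K, locV K (Q K).1 r.1 = -locA ha K (G K).1 r.1 := by
  have h : ∀ v : L.Vh, (innerV Q v = -innerA a G v) ↔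
      ∑ K, locV K (Q K).1 (v K).1 = ∑ K, -locA ha K (G K).1 (v K).1 := by
    intro v
    rw [Finset.sum_neg_distrib]
    rfl
  simp only [IsQ, h]
  rw [pi_sum_eq_iff Finset.univ (φ := fun K (r : L.V K) => locV K (Q K).1 r.1)
    (ψ := fun K (r : L.V K) => -locA ha K (G K).1 r.1)]
  · simp
  · intro K; simp
  · intro K; simp

theorem existsUnique_isQ (ha : ∀ i j, MemLp (fun x => a x i j) ⊤ (volume.restrict Ω)) (G : L.Vh) :
    ∃! Q : L.Vh, IsQ L a G Q := by
  simp only [isQ_iff L ha]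
  choose Q hQ hQ' using fun K =>
    existsUnique_locV L K (-(locA ha K (G K).1).domRestrict (L.V K))
  exact ⟨Q, hQ, fun Q' h => funext fun K => hQ' K _ (h K)⟩

/-- `GMap`, `QMap` and `weakGradient` are chosen by `Classical.epsilon`: existence makes the choice
a solution, uniqueness makes it the only one. -/
theorem epsilon_iff_of_existsUnique {α : Sort*} [Nonempty α] {p : α → Prop} (h : ∃! x, p x)
    (x : α) : p x ↔ x = Classical.epsilon p := by
  have h1 : p (Classical.epsilon p) := Classical.epsilon_spec h.exists
  exact ⟨fun hx => h.unique hx h1, fun hx => hx ▸ h1⟩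

variable {L}

theorem isG_iff_eq_GMap {w : VolFun T} {what : BdryFun T} (hw : MemL2Vol w)
    (hwhat : MemL2Bdry what) (G : L.Vh) : IsG L w what G ↔ G = GMap L w what :=
  epsilon_iff_of_existsUnique (existsUnique_isG L hw hwhat) G

theorem isQ_iff_eq_QMap (ha : ∀ i j, MemLp (fun x => a x i j) ⊤ (volume.restrict Ω))
    (w : VolFun T) (what : BdryFun T) (Q : L.Vh) :
    IsQ L a (GMap L w what) Q ↔ Q = QMap L a w what :=
  epsilon_iff_of_existsUnique (existsUnique_isQ L ha _) Q

theorem isG_GMap {w : VolFun T} {what : BdryFun T} (hw : MemL2Vol w)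
    (hwhat : MemL2Bdry what) : IsG L w what (GMap L w what) := (isG_iff_eq_GMap hw hwhat _).2 rfl

theorem isWeakGradient_iff_eq_GMap {w : VolFun T} {what : BdryFun T} (hw : MemL2Vol w)
    (hwhat : MemL2Bdry what) (K : T.Elem) (g : L.V K) :
    IsWeakGradient L K (w K) (what K) g ↔ g = GMap L w what K := by
  have h1 := (isG_iff L w what _).1 (isG_GMap hw hwhat) K
  exact ⟨fun h => (existsUnique_isWeakGradient L (hw K) (hwhat K)).unique h h1, fun h => h ▸ h1⟩

theorem weakGradient_eq {w : VolFun T} {what : BdryFun T} (hw : MemL2Vol w)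
    (hwhat : MemL2Bdry what) (K : T.Elem) :
    weakGradient L K (w K) (what K) = GMap L w what K := by
  rw [← isWeakGradient_iff_eq_GMap hw hwhat]
  exact Classical.epsilon_spec (existsUnique_isWeakGradient L (hw K) (hwhat K)).exists

theorem memL2Vol_comb {w w' : VolFun T} (hw : MemL2Vol w) (hw' : MemL2Vol w') (s : ℝ) :
    MemL2Vol (s • w + w') := fun K => ((hw K).const_smul s).add (hw' K)

theorem memL2Bdry_comb {m m' : BdryFun T} (hm : MemL2Bdry m) (hm' : MemL2Bdry m') (s : ℝ) :
    MemL2Bdry (s • m + m') := fun K F hF => ((hm K F hF).const_smul s).add (hm' K F hF)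

/-- By uniqueness it is enough that the combination of the two solutions solves the problem with the
combined data. -/
theorem GMap_comb {w w' : VolFun T} {m m' : BdryFun T} (hw : MemL2Vol w) (hm : MemL2Bdry m)
    (hw' : MemL2Vol w') (hm' : MemL2Bdry m') (s : ℝ) :
    GMap L (s • w + w') (s • m + m') = s • GMap L w m + GMap L w' m' := by
  symm
  rw [← isG_iff_eq_GMap (memL2Vol_comb hw hw' s) (memL2Bdry_comb hm hm' s), isG_iff]
  intro K
  rw [isWeakGradient_iff]
  intro r
  have h := (isG_iff L w m _).1 (isG_GMap hw hm) K r
  have h' := (isG_iff L w' m' _).1 (isG_GMap hw' hm') K r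
  have h2 := weakRhs_data (hw K) (hm K) (hw' K) (hm' K) s r.1
  refine Eq.trans ?_ h2.symm
  rw [Pi.add_apply, Pi.smul_apply, Submodule.coe_add, Submodule.coe_smul, map_add, map_smul]
  simp only [LinearMap.add_apply, LinearMap.smul_apply, smul_eq_mul]
  exact congrArg₂ (· + ·) (congrArg (s * ·) h) h'

theorem QMap_comb (ha : ∀ i j, MemLp (fun x => a x i j) ⊤ (volume.restrict Ω))
    {w w' : VolFun T} {m m' : BdryFun T} (hw : MemL2Vol w) (hm : MemL2Bdry m)
    (hw' : MemL2Vol w') (hm' : MemL2Bdry m') (s : ℝ) :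
    QMap L a (s • w + w') (s • m + m') = s • QMap L a w m + QMap L a w' m' := by
  symm
  rw [← isQ_iff_eq_QMap ha, isQ_iff L ha, GMap_comb hw hm hw' hm']
  intro K r
  have h := (isQ_iff L ha _ _).1 ((isQ_iff_eq_QMap ha w m _).2 rfl) K r
  have h' := (isQ_iff L ha _ _).1 ((isQ_iff_eq_QMap ha w' m' _).2 rfl) K r
  rw [Pi.add_apply, Pi.smul_apply, Submodule.coe_add, Submodule.coe_smul, Pi.add_apply,
    Pi.smul_apply, Submodule.coe_add, Submodule.coe_smul, map_add, map_smul, map_add, map_smul]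
  simp only [LinearMap.add_apply, LinearMap.smul_apply, smul_eq_mul, h, h']
  ring

end Local

/-! ### Equivalence of the HDG, weak Galerkin and hybridized methods. -/

section Global
variable {d : ℕ} {Ω : Set (E d)} {T : Mesh d Ω} {L : LocalSpaces T}

theorem LocalSpaces.exists_pol (L : LocalSpaces T) {F : T.Face} (μ : L.M F) :
    ∃ p : Pol d, ∀ x, μ.1 x = ev p x.1 := by
  obtain ⟨p, hp⟩ := L.polM F μ.2
  exact ⟨p, fun x => (congrFun hp x).symm⟩

theorem LocalSpaces.continuous_M (L : LocalSpaces T) {F : T.Face} (μ : L.M F) :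
    Continuous μ.1 := by
  obtain ⟨p, hp⟩ := L.exists_pol μ
  have : μ.1 = fun x => ev p x.1 := funext hp
  rw [this]
  fun_prop

theorem LocalSpaces.eq_zero_of_integral_sq (L : LocalSpaces T) {F : T.Face} {μ : L.M F}
    (h : ∫ x, μ.1 x * μ.1 x ∂F.surf = 0) : μ = 0 := by
  obtain ⟨p, hp⟩ := L.exists_pol μ
  simp only [hp] at h
  ext x
  rw [hp]
  exact F.eq_zero_of_integral_sq (continuous_ev p) h x.1 x.2

theorem memL2Vol_volW (w : L.Wh) : MemL2Vol (volW w) := fun K => by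
  have hc : Continuous (volW w K) := continuous_ev _
  exact (memLp_two_iff_integrable_sq hc.aestronglyMeasurable).2
    (K.integrable_of_continuous (by fun_prop))

theorem memL2Bdry_of_continuous {m : BdryFun T} (hm : ∀ K, ∀ F, Continuous (m K F)) :
    MemL2Bdry m := fun K F _ =>
  (memLp_two_iff_integrable_sq (hm K F).aestronglyMeasurable).2
    (F.integrable_surf ((hm K F).pow 2))

theorem continuous_trM (μ : L.Mh) (K : T.Elem) (F : T.Face) : Continuous (trM μ K F) :=
  L.continuous_M (μ F)

theorem continuous_trW (w : L.Wh) (K : T.Elem) (F : T.Face) : Continuous (trW w K F) :=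
  (continuous_ev _).comp continuous_subtype_val

theorem continuous_trN (v : L.Vh) (K : T.Elem) (F : T.Face) : Continuous (trN v K F) :=
  (continuous_vev_dot_const _ _).comp continuous_subtype_val

theorem memL2Bdry_trM (μ : L.Mh) : MemL2Bdry (trM μ) := memL2Bdry_of_continuous (continuous_trM μ)

theorem innerBdry_add_left {m m' r : BdryFun T}
    (h : ∀ K, ∀ F ∈ K.faces, Integrable (fun x => m K F x * r K F x) F.surf)
    (h' : ∀ K, ∀ F ∈ K.faces, Integrable (fun x => m' K F x * r K F x) F.surf) :
    innerBdry (m + m') r = innerBdry m r + innerBdry m' r := by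
  simp only [innerBdry, Pi.add_apply, add_mul, ← Finset.sum_add_distrib]
  exact Finset.sum_congr rfl fun K _ => Finset.sum_congr rfl fun F hF =>
    integral_add (h K F hF) (h' K F hF)

theorem innerBdry_sub_right {m r r' : BdryFun T}
    (h : ∀ K, ∀ F ∈ K.faces, Integrable (fun x => m K F x * r K F x) F.surf)
    (h' : ∀ K, ∀ F ∈ K.faces, Integrable (fun x => m K F x * r' K F x) F.surf) :
    innerBdry m (r - r') = innerBdry m r - innerBdry m r' := by
  simp only [innerBdry, Pi.sub_apply, mul_sub, ← Finset.sum_sub_distrib]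
  exact Finset.sum_congr rfl fun K _ => Finset.sum_congr rfl fun F hF =>
    integral_sub (h K F hF) (h' K F hF)

theorem innerBdry_comm (m r : BdryFun T) : innerBdry m r = innerBdry r m := by
  simp only [innerBdry, mul_comm]

theorem innerVol_comm (m r : VolFun T) : innerVol m r = innerVol r m := by
  simp only [innerVol, mul_comm]

theorem innerV_comm (g v : L.Vh) : innerV g v = innerV v g := by
  simp only [innerV, dotProduct_comm]

/-- Integration by parts, element by element. -/
theorem innerGrad_add (hd : 1 ≤ d) (q : L.Vh) (w : L.Wh) :
    innerGrad q w + innerVol (volDiv q) (volW w) = innerBdry (trN q) (trW w) := by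
  simp only [innerGrad, innerVol, innerBdry, ← Finset.sum_add_distrib]
  refine Finset.sum_congr rfl fun K _ => ?_
  have h := K.integral_by_parts hd (q K).1 (φ := ev (w K).1) (contDiff_ev _)
  have h1 : ∀ x, (fun i => fderiv ℝ (ev (w K).1) x (EuclideanSpace.single i 1)) =
      vev (pgrad (w K).1) x := by
    intro x
    ext i
    rw [fderiv_ev, Finset.sum_eq_single i]
    · simp [vev, pgrad]
    · intro j _ hj; simp [hj]
    · simp
  simp only [h1] at h
  refine Eq.trans ?_ (h.trans ?_)
  · simp only [volDiv, volW, mul_comm]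
  · simp only [trN, trW, mul_comm]

/-- `M_h` is a product over faces, so the boundary condition tested on all of `∂Ω` is the facewise
`L²` projection used by the other two methods. -/
theorem mem_MhBC_iff (ζ : L.Mh) (η : E d → ℝ) :
    ζ ∈ MhBC L η ↔ ∀ F : T.Face, F.IsBoundary → ∀ μ : L.M F,
      ∫ x, (ζ F).1 x * μ.1 x ∂F.surf = ∫ x : F.set, η x.1 * μ.1 x ∂F.surf := by
  classical
  have h := pi_sum_eq_iff (Finset.univ.filter fun F : T.Face => F.IsBoundary)
    (φ := fun F (μ : L.M F) => ∫ x, μ.1 x * (ζ F).1 x ∂F.surf)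
    (ψ := fun F (μ : L.M F) => ∫ x : F.set, μ.1 x * η x.1 ∂F.surf) (by simp) (by simp)
  simp only [MhBC, Set.mem_ofPred_eq, innerOmega, innerOmegaFun]
  refine Iff.trans (Iff.of_eq ?_) (h.trans ?_)
  · congr! 4
  · simp only [Finset.mem_filter, Finset.mem_univ, true_and, mul_comm]

/-- Testing with `ζ F` itself, since the `L²(F)` form is definite on `M(F)`. Thus `M_h(0)` is the
multiplier part of the WG test space. -/
theorem mem_MhBC_zero_iff (ζ : L.Mh) :
    ζ ∈ MhBC L 0 ↔ ∀ F : T.Face, F.IsBoundary → ζ F = 0 := by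
  rw [mem_MhBC_iff]
  refine forall_congr' fun F => forall_congr' fun _ => ⟨fun h => ?_, fun h μ => ?_⟩
  · exact L.eq_zero_of_integral_sq (by simpa using h (ζ F))
  · simp [h]

open Classical in
/-- The part of a member of `M_h` supported on the faces that do not lie on `∂Ω`. -/
noncomputable def interiorPart (μ : L.Mh) : L.Mh := fun F => if F.IsBoundary then 0 else μ F

theorem interiorPart_apply_of_isBoundary (μ : L.Mh) {F : T.Face} (hF : F.IsBoundary) :
    interiorPart μ F = 0 := if_pos hF

theorem interiorPart_apply_of_not_isBoundary (μ : L.Mh) {F : T.Face} (hF : ¬F.IsBoundary) :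
    interiorPart μ F = μ F := if_neg hF

theorem innerBdry_trM_eq {μ : L.Mh} (hμ : ∀ F : T.Face, F.IsBoundary → μ F = 0) (m : BdryFun T) :
    innerBdry (trM μ) m = innerBdryInt (trM μ) m := by
  classical
  simp only [innerBdry, innerBdryInt]
  refine Finset.sum_congr rfl fun K _ => ?_
  rw [Finset.sum_filter]
  refine Finset.sum_congr rfl fun F _ => ?_
  split_ifs with h
  · simp [trM, hμ F h]
  · rfl

theorem innerBdryInt_interiorPart (μ : L.Mh) (m : BdryFun T) :
    innerBdryInt (trM (interiorPart μ)) m = innerBdryInt (trM μ) m := by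
  classical
  simp only [innerBdryInt]
  refine Finset.sum_congr rfl fun K _ => Finset.sum_congr rfl fun F hF => ?_
  simp only [trM]
  rw [interiorPart_apply_of_not_isBoundary μ (Finset.mem_filter.1 hF).2]

theorem isHDG_gradient_iff {g : L.Vh} {u : L.Wh} {uhat : L.Mh} :
    (∀ v : L.Vh, -innerV g v - innerVol (volW u) (volDiv v) + innerBdry (trM uhat) (trN v) = 0) ↔
      g = GMap L (volW u) (trM uhat) := by
  rw [← isG_iff_eq_GMap (memL2Vol_volW u) (memL2Bdry_trM uhat)]
  exact forall_congr' fun v => ⟨fun h => by linarith, fun h => by linarith⟩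

variable {a : E d → Matrix (Fin d) (Fin d) ℝ}

theorem isHDG_iff (hd : 1 ≤ d) (ha : ∀ i j, MemLp (fun x => a x i j) ⊤ (volume.restrict Ω))
    (f uD : E d → ℝ) {τ : BdryFun T} (hτ : MemLinfBdry τ) (q g : L.Vh) (u : L.Wh) (uhat : L.Mh) :
    IsHDG L a τ f uD q g u uhat ↔
      g = GMap L (volW u) (trM uhat) ∧ q = QMap L a (volW u) (trM uhat) ∧ uhat ∈ MhBC L uD ∧
      ∀ (w : L.Wh) (what : L.Mh), what ∈ MhBC L 0 →
        innerA a (GMap L (volW u) (trM uhat)) (GMap L (volW w) (trM what)) +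
          innerBdry (τ * (trW u - trM uhat)) (trW w - trM what) =
        innerVol (fun _ => f) (volW w) := by
  have hint : ∀ {r : BdryFun T}, (∀ K F, Continuous (r K F)) → ∀ K, ∀ F ∈ K.faces,
      Integrable (fun x => (τ * (trW u - trM uhat)) K F x * r K F x) F.surf := by
    intro r hr K F hF
    simp only [Pi.mul_apply, Pi.sub_apply, mul_assoc]
    exact F.integrable_mul ((hτ K F hF).integrable le_top)
      (((continuous_trW u K F).sub (continuous_trM uhat K F)).mul (hr K F))
  have hflux : ∀ {r : BdryFun T}, (∀ K F, Continuous (r K F)) →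
      innerBdry (numFlux τ q u uhat) r =
        innerBdry (trN q) r + innerBdry (τ * (trW u - trM uhat)) r := fun {r} hr =>
    innerBdry_add_left
      (fun K F _ => F.integrable_surf ((continuous_trN q K F).mul (hr K F))) (hint hr)
  -- The heart of the equivalence: the equation of `Q_u` is tested with `G_w`, that of `G_w` with
  -- `q`, and `(w, ∇·q)` is integrated by parts. The reduced form becomes the conservation form at
  -- `w` minus the transmission form at `ŵ`, taken over all of `∂𝒯_h`.
  have key : g = GMap L (volW u) (trM uhat) → q = QMap L a (volW u) (trM uhat) →
      ∀ (w : L.Wh) (what : L.Mh),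
        innerA a (GMap L (volW u) (trM uhat)) (GMap L (volW w) (trM what)) +
          innerBdry (τ * (trW u - trM uhat)) (trW w - trM what) =
        (-innerGrad q w + innerBdry (numFlux τ q u uhat) (trW w)) -
          innerBdry (trM what) (numFlux τ q u uhat) := by
    intro hg hq w what
    have h1 := (isQ_iff_eq_QMap ha (volW u) (trM uhat) q).2 hq (GMap L (volW w) (trM what))
    have h2 := isG_GMap (L := L) (memL2Vol_volW w) (memL2Bdry_trM what) q
    have h3 := innerGrad_add hd q w
    rw [innerBdry_sub_right (hint (continuous_trW w)) (hint (continuous_trM what)),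
      hflux (continuous_trW w), innerBdry_comm (trM what), hflux (continuous_trM what)]
    rw [innerV_comm] at h2
    rw [innerVol_comm] at h3
    rw [innerBdry_comm (trM what)] at h2
    linarith
  constructor
  · intro h
    have hg := isHDG_gradient_iff.1 h.gradient
    have hq : q = QMap L a (volW u) (trM uhat) := by
      rw [← isQ_iff_eq_QMap ha, ← hg]; exact h.flux
    refine ⟨hg, hq, h.boundary, fun w what hwhat => ?_⟩
    rw [key hg hq, h.conservation, innerBdry_trM_eq ((mem_MhBC_zero_iff _).1 hwhat),
      h.transmission, sub_zero]
  · rintro ⟨hg, hq, hb, h⟩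
    refine ⟨isHDG_gradient_iff.2 hg, ?_, fun w => ?_, fun μ => ?_, hb⟩
    · rw [hg]; exact (isQ_iff_eq_QMap ha _ _ _).2 hq
    -- Taking `ŵ = 0` recovers conservation; in the next case `w = 0` recovers transmission, which
    -- sees only the interior part of `μ`.
    · have h0 : (0 : L.Mh) ∈ MhBC L 0 := (mem_MhBC_zero_iff _).2 fun _ _ => rfl
      have h1 := h w 0 h0
      rw [key hg hq] at h1
      rw [← h1]
      simp [innerBdry, trM]
    · have h0 : interiorPart μ ∈ MhBC L 0 :=
        (mem_MhBC_zero_iff _).2 fun _ hF => interiorPart_apply_of_isBoundary μ hF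
      have h1 := h 0 _ h0
      rw [key hg hq, innerBdry_trM_eq ((mem_MhBC_zero_iff _).1 h0), innerBdryInt_interiorPart] at h1
      have h2 : innerGrad q (0 : L.Wh) = 0 := by
        have : pgrad (0 : Pol d) = 0 := by ext; simp [pgrad]
        simp [innerGrad, this]
      have h3 : innerBdry (numFlux τ q u uhat) (trW (0 : L.Wh)) = 0 := by simp [innerBdry, trW]
      have h4 : innerVol (fun _ => f) (volW (0 : L.Wh)) = 0 := by simp [innerVol, volW]
      rw [h2, h3, h4] at h1
      linarith

theorem isHDG_zero_iff_isWG (hd : 1 ≤ d)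
    (ha : ∀ i j, MemLp (fun x => a x i j) ⊤ (volume.restrict Ω))
    (f uD : E d → ℝ) (q g : L.Vh) (u : L.Wh) (uhat : L.Mh) :
    IsHDG L a 0 f uD q g u uhat ↔
      g = GMap L (volW u) (trM uhat) ∧ q = QMap L a (volW u) (trM uhat) ∧
        IsWG L a f uD u uhat := by
  have h0 : MemLinfBdry (0 : BdryFun T) := fun K F _ => MemLp.zero
  have hG : ∀ (w : L.Wh) (what : L.Mh) (K : T.Elem),
      weakGradient L K (volW w K) (fun F => (what F).1) = GMap L (volW w) (trM what) K :=
    fun w what K => weakGradient_eq (memL2Vol_volW w) (memL2Bdry_trM what) K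
  have hb : ∀ r : BdryFun T, innerBdry 0 r = 0 := fun r => by simp [innerBdry]
  rw [isHDG_iff hd ha f uD h0, mem_MhBC_iff]
  refine and_congr_right fun _ => and_congr_right fun _ => ⟨fun h => ⟨h.1, ?_⟩, fun h => ⟨h.1, ?_⟩⟩
  · intro w what hwhat
    have h1 := h.2 w what ((mem_MhBC_zero_iff _).2 hwhat)
    simp only [hG]
    rw [zero_mul, hb, add_zero] at h1
    exact h1
  · intro w what hwhat
    have h1 := h.scheme w what ((mem_MhBC_zero_iff _).1 hwhat)
    simp only [hG] at h1
    rw [zero_mul, hb, add_zero]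
    exact h1

theorem isHDG_zero_iff_isHybridMixed (hd : 1 ≤ d) (f uD : E d → ℝ) (q g : L.Vh) (u : L.Wh)
    (uhat : L.Mh) :
    IsHDG L a 0 f uD q g u uhat ↔ IsHybridMixed L a f uD q g u uhat := by
  have hn : numFlux 0 q u uhat = trN q := by
    funext K F x
    simp [numFlux]
  constructor
  · intro h
    refine ⟨fun v => by linarith [h.gradient v], fun v => by linarith [h.flux v], fun w => ?_,
      fun μ => ?_, (mem_MhBC_iff _ _).1 h.boundary⟩
    · have := h.conservation w
      rw [hn] at this
      linarith [innerGrad_add hd q w]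
    · have := h.transmission μ
      rwa [hn] at this
  · intro h
    refine ⟨fun v => by linarith [h.gradient v], fun v => by linarith [h.flux v], fun w => ?_,
      fun μ => ?_, (mem_MhBC_iff _ _).2 h.boundary⟩
    · rw [hn]
      linarith [innerGrad_add hd q w, h.conservation w]
    · rw [hn]
      exact h.continuity μ

end Global

/-! ### Normal jumps and membership in `H(div, Ω)`. -/

section Jump
variable {d : ℕ} {Ω : Set (E d)} {T : Mesh d Ω} {L : LocalSpaces T}

open Classical in
theorem sum_elem_face (t : T.Elem → T.Face → ℝ) :
    ∑ K, ∑ F ∈ K.faces, t K F = ∑ F, ∑ K : T.Elem with F ∈ K.faces, t K F :=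
  Finset.sum_comm' (by simp)

open Classical in
theorem sum_elem_face_interior (t : T.Elem → T.Face → ℝ) :
    ∑ K, ∑ F ∈ K.faces with ¬F.IsBoundary, t K F =
      ∑ F : T.Face with ¬F.IsBoundary, ∑ K : T.Elem with F ∈ K.faces, t K F :=
  Finset.sum_comm' (by simp)

open Classical in
/-- The sum over the elements at a face `F` of the normal components of a member of `V_h`, as a
polynomial. -/
noncomputable def jumpPol (v : L.Vh) (F : T.Face) : Pol d :=
  ∑ K : T.Elem with F ∈ K.faces, ∑ i, normal K F i • (v K).1 i

open Classical in
theorem ev_jumpPol (v : L.Vh) (F : T.Face) (x : E d) :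
    ev (jumpPol v F) x = ∑ K : T.Elem with F ∈ K.faces,
      vev (v K).1 x ⬝ᵥ fun i => normal K F i := by
  rw [jumpPol, ev_sum]
  refine Finset.sum_congr rfl fun K _ => ?_
  rw [ev_sum]
  exact Finset.sum_congr rfl fun i _ => by rw [ev_smul, mul_comm]; rfl

theorem integral_mul_ev_jumpPol (v : L.Vh) (F : T.Face) {m : F.set → ℝ} (hm : Continuous m) :
    ∫ x, m x * ev (jumpPol v F) x.1 ∂F.surf =
      open Classical in ∑ K : T.Elem with F ∈ K.faces, ∫ x, m x * trN v K F x ∂F.surf := by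
  classical
  rw [← integral_finsetSum _ fun K _ =>
    F.integrable_surf (g := fun x => m x * trN v K F x) (hm.mul (continuous_trN v K F))]
  simp only [← Finset.mul_sum]
  congr! 3 with x
  exact ev_jumpPol v F x.1

/-- A multiplier is single-valued on `F`, so it tests the sum of the normal components from all
elements at `F`; the number of these elements never matters. -/
theorem innerBdryInt_trM_trN (μ : L.Mh) (v : L.Vh) :
    innerBdryInt (trM μ) (trN v) = open Classical in
      ∑ F : T.Face with ¬F.IsBoundary, ∫ x, (μ F).1 x * ev (jumpPol v F) x.1 ∂F.surf := by
  classical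
  have h := sum_elem_face_interior (T := T) fun K F => ∫ x, trM μ K F x * trN v K F x ∂F.surf
  simp only [innerBdryInt]
  convert h using 1
  refine Finset.sum_congr (by congr!) fun F _ => ?_
  rw [integral_mul_ev_jumpPol v F (L.continuous_M (μ F))]
  congr! 1

/-- The divergence of a member of `V_h`, element by element, as a function on `ℝ^d`. -/
noncomputable def glueDiv (v : L.Vh) : E d → ℝ := fun x =>
  ∑ K : T.Elem, (interior K.set).indicator (ev (pdiv (v K).1)) x

theorem memLp_indicator_interior {W : Type*} [NormedAddCommGroup W]
    [SecondCountableTopologyEither (E d) W] (K : T.Elem) {g : E d → W}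
    (hg : Continuous g) : MemLp ((interior K.set).indicator g) 2 (volume.restrict Ω) := by
  rw [memLp_indicator_iff_restrict isOpen_interior.measurableSet,
    Measure.restrict_restrict isOpen_interior.measurableSet,
    Set.inter_eq_left.2 K.interior_subset, K.restrict_interior,
    memLp_two_iff_integrable_sq_norm hg.aestronglyMeasurable]
  exact K.integrable_of_continuous (by fun_prop)

theorem setIntegral_indicator_interior (K : T.Elem) (g : E d → ℝ) :
    ∫ x in Ω, (interior K.set).indicator g x = ∫ x in K.set, g x := by
  rw [setIntegral_indicator isOpen_interior.measurableSet, Set.inter_eq_right.2 K.interior_subset,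
    K.restrict_interior]

theorem setIntegral_sum_indicator_interior {g : T.Elem → E d → ℝ} (hg : ∀ K, Continuous (g K)) :
    ∫ x in Ω, ∑ K, (interior K.set).indicator (g K) x = ∑ K, ∫ x in K.set, g K x := by
  rw [integral_finsetSum]
  · exact Finset.sum_congr rfl fun K _ => setIntegral_indicator_interior K _
  · intro K _
    rw [integrable_indicator_iff isOpen_interior.measurableSet, IntegrableOn,
      Measure.restrict_restrict isOpen_interior.measurableSet,
      Set.inter_eq_left.2 K.interior_subset, K.restrict_interior]
    exact K.integrable_of_continuous (hg K)

theorem memLp_glueDiv (v : L.Vh) : MemLp (glueDiv v) 2 (volume.restrict Ω) :=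
  memLp_finsetSum _ fun K _ => memLp_indicator_interior K (continuous_ev _)

theorem memLp_glue (v : L.Vh) : MemLp (glue v) 2 (volume.restrict Ω) :=
  memLp_finsetSum _ fun K _ => memLp_indicator_interior K (by fun_prop)

theorem inner_toLp_gradient (φ : E d → ℝ) (w : Fin d → ℝ) (x : E d) :
    inner ℝ (WithLp.toLp 2 w) (gradient φ x) =
      w ⬝ᵥ fun i => fderiv ℝ φ x (EuclideanSpace.single i 1) := by
  rw [inner_gradient_right]
  have h : WithLp.toLp 2 w = ∑ i, w i • EuclideanSpace.single i (1 : ℝ) := by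
    ext j
    simp [Pi.single_apply]
  rw [h, map_sum]
  simp [dotProduct]

/-- Integration by parts on each element, with the boundary terms regrouped by faces. For `φ`
supported in `Ω` it reads: the distributional divergence is the elementwise one minus a surface
density given by the jumps. -/
theorem integral_glue_gradient (hd : 1 ≤ d) (v : L.Vh) {φ : E d → ℝ} (hφ : ContDiff ℝ 1 φ) :
    ∫ x in Ω, inner ℝ (glue v x) (gradient φ x) =
      -(∫ x in Ω, glueDiv v x * φ x) + ∑ F : T.Face, ∫ x : F.set, φ x.1 * ev (jumpPol v F) x.1 ∂F.surf := by
  classical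
  have hφ' : ∀ i : Fin d, Continuous fun x => fderiv ℝ φ x (EuclideanSpace.single i 1) := fun i =>
    (hφ.continuous_fderiv one_ne_zero).clm_apply continuous_const
  have hφc := hφ.continuous
  have h1 : ∫ x in Ω, inner ℝ (glue v x) (gradient φ x) =
      ∑ K, ∫ x in K.set, vev (v K).1 x ⬝ᵥ fun i => fderiv ℝ φ x (EuclideanSpace.single i 1) := by
    rw [← setIntegral_sum_indicator_interior fun K => by unfold dotProduct; fun_prop]
    congr 1
    ext x
    rw [glue, sum_inner]
    refine Finset.sum_congr rfl fun K _ => ?_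
    by_cases hx : x ∈ interior K.set
    · rw [Set.indicator_of_mem hx, Set.indicator_of_mem hx, inner_toLp_gradient]
    · rw [Set.indicator_of_notMem hx, Set.indicator_of_notMem hx, inner_zero_left]
  have h2 : ∫ x in Ω, glueDiv v x * φ x = ∑ K, ∫ x in K.set, φ x * ev (pdiv (v K).1) x := by
    rw [← setIntegral_sum_indicator_interior fun K => by fun_prop]
    congr 1
    ext x
    rw [glueDiv, Finset.sum_mul]
    refine Finset.sum_congr rfl fun K _ => ?_
    by_cases hx : x ∈ interior K.set
    · rw [Set.indicator_of_mem hx, Set.indicator_of_mem hx, mul_comm]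
    · rw [Set.indicator_of_notMem hx, Set.indicator_of_notMem hx, zero_mul]
  have h3 := sum_elem_face (T := T) fun K F => ∫ x : F.set, φ x.1 * trN v K F x ∂F.surf
  have h4 : ∀ F : T.Face, ∫ x : F.set, φ x.1 * ev (jumpPol v F) x.1 ∂F.surf =
      ∑ K : T.Elem with F ∈ K.faces, ∫ x : F.set, φ x.1 * trN v K F x ∂F.surf := fun F =>
    integral_mul_ev_jumpPol v F (m := fun x => φ x.1) (by fun_prop)
  rw [h1, h2, Finset.sum_congr rfl fun F _ => h4 F, ← h3, neg_add_eq_sub, eq_sub_iff_add_eq,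
    ← Finset.sum_add_distrib]
  exact Finset.sum_congr rfl fun K _ => K.integral_by_parts hd (v K).1 hφ

theorem Mesh.Face.volume_set (F : T.Face) : volume F.set = 0 := by
  refine measure_mono_null (convexHull_subset_affineSpan _)
    (Measure.addHaar_affineSubspace volume (affineSpan ℝ (F.1 : Set (E d))) fun h => ?_)
  have h1 := F.finrank_dir
  have h2 := F.one_le_dim
  rw [Face.dir, ← direction_affineSpan, h, AffineSubspace.direction_top, finrank_top,
    finrank_euclideanSpace, Fintype.card_fin] at h1
  omega

/-- In a simplicial complex two faces meet in the hull of their common vertices. These form a proper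
subset of the vertices of `F`, as both faces have `d` of them, so the intersection is convex without
interior and lies in its own null frontier. -/
theorem Mesh.Face.volume_preimage_inter {F F' : T.Face} (h : F' ≠ F) :
    volume (F.dom ∩ F.param ⁻¹' F'.set) = 0 := by
  classical
  have h1 : F.dom ∩ F.param ⁻¹' F'.set =
      F.param ⁻¹' (convexHull ℝ ((F.1 : Set (E d)) ∩ (F'.1 : Set (E d)))) := by
    rw [← T.cx.convexHull_inter_convexHull F.2.1 F'.2.1]; rfl
  have hss : (F.1 : Set (E d)) ∩ (F'.1 : Set (E d)) ⊂ (F.1 : Set (E d)) := by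
    refine ⟨Set.inter_subset_left, fun hsub => h (Subtype.ext ?_)⟩
    have h2 : F.1 ⊆ F'.1 := fun x hx => (hsub hx).2
    exact (Finset.eq_of_subset_of_card_le h2 (by rw [F.2.2, F'.2.2])).symm
  have h3 := F.interior_preimage_convexHull_eq_empty hss
  have h4 : Convex ℝ (F.param ⁻¹' (convexHull ℝ ((F.1 : Set (E d)) ∩ (F'.1 : Set (E d))))) :=
    (convex_convexHull ℝ _).affine_preimage _
  rw [h1]
  refine measure_mono_null ?_ (h4.addHaar_frontier volume)
  rw [frontier, h3, Set.sdiff_empty]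
  exact subset_closure

/-- A face lies in the closure of `Ω`; if it is not in the frontier, it meets the open set `Ω` in a
relatively open set of positive measure. The other faces cover only a null part of it, so some point
sees no face but `F`. -/
theorem Mesh.Face.exists_mem_notMem {F : T.Face} (hF : ¬F.IsBoundary) :
    (interior F.dom ∩ F.param ⁻¹' (Ω \ ⋃ (F' : T.Face) (_ : F' ≠ F), F'.set)).Nonempty := by
  have hcont : Continuous F.param := F.isometry_param.continuous
  obtain ⟨K, hK⟩ := F.exists_elem
  have h1 : ∃ x ∈ F.set, x ∈ Ω := by
    by_contra! hno
    refine hF fun x hx => ?_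
    rw [T.isOpen.frontier_eq]
    exact ⟨K.set_subset_closure (Face.set_subset_elem hK hx), hno x hx⟩
  obtain ⟨x, hx, hxΩ⟩ := h1
  obtain ⟨z, rfl⟩ := F.set_subset_range hx
  have h2 : F.dom ⊆ closure (interior F.dom) := by
    rw [F.convex_dom.closure_interior_eq_closure_of_nonempty_interior F.interior_dom_nonempty]
    exact subset_closure
  have hopen : IsOpen (F.param ⁻¹' Ω) := T.isOpen.preimage hcont
  have h3 : (interior F.dom ∩ F.param ⁻¹' Ω).Nonempty := by
    rw [Set.inter_comm]
    exact mem_closure_iff.1 (h2 hx) _ hopen hxΩ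
  have h4 : 0 < volume (interior F.dom ∩ F.param ⁻¹' Ω) :=
    (isOpen_interior.inter hopen).measure_pos volume h3
  by_contra hemp
  rw [Set.not_nonempty_iff_eq_empty] at hemp
  refine h4.ne' (measure_mono_null (t := ⋃ (F' : T.Face) (_ : F' ≠ F),
    F.dom ∩ F.param ⁻¹' F'.set) (fun y hy => ?_) ?_)
  · by_contra hy'
    simp only [Set.mem_iUnion, Set.mem_inter_iff, not_exists, not_and] at hy'
    have : y ∈ (∅ : Set F.dir) := by
      rw [← hemp]
      refine ⟨hy.1, hy.2, ?_⟩
      simp only [Set.mem_iUnion, not_exists]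
      exact fun F' hF' => hy' F' hF' (interior_subset hy.1)
    exact this
  · exact (measure_iUnion_null_iff).2 fun F' => (measure_iUnion_null_iff).2 fun hF' =>
      Face.volume_preimage_inter hF'

/-- Identity theorem on the hyperplane of `F`: a jump known to vanish on one patch of the face
vanishes on all of it. -/
theorem Mesh.Face.ev_eq_zero_of_open {F : T.Face} {p : Pol d} {U : Set F.dir} (hU : IsOpen U)
    (hne : U.Nonempty) (h : ∀ z ∈ U, ev p (F.param z) = 0) (z : F.dir) :
    ev p (F.param z) = 0 := by
  obtain ⟨y, hy⟩ := hne
  have han : AnalyticOnNhd ℝ (fun z : F.dir => ev p (F.param z)) Set.univ := by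
    have h1 : AnalyticOnNhd ℝ (fun z : F.dir => (z : E d) + F.pt) Set.univ :=
      (F.dir.subtypeL.analyticOnNhd _).add analyticOnNhd_const
    simp only [Face.param_apply]
    exact (analyticOnNhd_ev p).comp h1 fun _ _ => trivial
  have h1 : (fun z : F.dir => ev p (F.param z)) =ᶠ[nhds y] 0 := by
    filter_upwards [hU.mem_nhds hy] with w hw
    exact h w hw
  exact han.eqOn_zero_of_preconnected_of_eventuallyEq_zero isPreconnected_univ (Set.mem_univ y) h1
    (Set.mem_univ z)

theorem mem_ConformingV_iff (hd : 1 ≤ d) (v : L.Vh) :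
    v ∈ ConformingV L ↔ ∀ F : T.Face, ¬F.IsBoundary → ∀ x ∈ F.set, ev (jumpPol v F) x = 0 := by
  have hout : ∀ {φ : E d → ℝ} {U : Set (E d)}, tsupport φ ⊆ U → ∀ {x}, x ∉ U → φ x = 0 :=
    fun {φ U} hφ {x} hx => image_eq_zero_of_notMem_tsupport fun h => hx (hφ h)
  constructor
  · rintro ⟨-, r, hr, hrφ⟩ F hF
    have hclosed : ∀ s : Set T.Face, IsClosed (⋃ F ∈ s, F.set) := fun s =>
      s.toFinite.isClosed_biUnion fun F _ => F.isCompact_set.isClosed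
    have hdiff : MemLp (fun x => glueDiv v x - r x) 2 (volume.restrict Ω) :=
      (memLp_glueDiv v).sub hr
    have hbdd : ∀ {φ : E d → ℝ}, Continuous φ → HasCompactSupport φ → ∀ {m : E d → ℝ},
        MemLp m 2 (volume.restrict Ω) → Integrable (fun x => m x * φ x) (volume.restrict Ω) := by
      intro φ hφ hc m hm
      have hφ2 : MemLp φ 2 (volume.restrict Ω) :=
        (hφ.memLp_of_hasCompactSupport hc).restrict Ω
      exact MemLp.integrable_mul hm hφ2
    have hid : ∀ φ : E d → ℝ, ContDiff ℝ ∞ φ → HasCompactSupport φ → tsupport φ ⊆ Ω →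
        ∫ x in Ω, φ x * (glueDiv v x - r x) =
          ∑ F : T.Face, ∫ x : F.set, φ x.1 * ev (jumpPol v F) x.1 ∂F.surf := by
      intro φ hφ hc hs
      have h1 := hrφ φ hφ hc hs
      rw [integral_glue_gradient hd v (hφ.of_le (by simp))] at h1
      have h2 : ∫ x in Ω, φ x * (glueDiv v x - r x) =
          (∫ x in Ω, glueDiv v x * φ x) - ∫ x in Ω, r x * φ x := by
        rw [← integral_sub (hbdd hφ.continuous hc (memLp_glueDiv v)) (hbdd hφ.continuous hc hr)]
        congr 1
        ext x
        ring
      rw [h2]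
      linarith
    -- Test functions supported off the faces do not see the jumps, so they identify the weak
    -- divergence with the elementwise one; the faces themselves are null.
    have hae : ∀ᵐ x ∂(volume.restrict Ω), glueDiv v x - r x = 0 := by
      have h1 : ∀ᵐ x ∂(volume.restrict Ω), x ∈ Ω \ (⋃ F ∈ (Set.univ : Set T.Face), F.set) →
          glueDiv v x - r x = 0 := by
        refine (T.isOpen.sdiff (hclosed _)).ae_eq_zero_of_integral_contDiff_smul_eq_zero
          ((hdiff.locallyIntegrable one_le_two).locallyIntegrableOn _) fun φ hφ hc hs => ?_
        simp only [smul_eq_mul]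
        rw [hid φ hφ hc (hs.trans Set.sdiff_subset)]
        refine Finset.sum_eq_zero fun F _ => integral_eq_zero_of_ae (.of_forall fun x => ?_)
        have : φ x.1 = 0 := hout hs fun h => h.2 (Set.mem_biUnion (Set.mem_univ F) x.2)
        simp [this]
      have h2 : ∀ᵐ x ∂(volume.restrict Ω), x ∉ ⋃ F ∈ (Set.univ : Set T.Face), F.set := by
        refine ae_restrict_of_ae (measure_eq_zero_iff_ae_notMem.1 ?_)
        simp only [Set.mem_univ, Set.iUnion_true]
        exact measure_iUnion_null fun F => F.volume_set
      filter_upwards [h1, h2, ae_restrict_mem T.isOpen.measurableSet] with x hx1 hx2 hx3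
      exact hx1 ⟨hx3, hx2⟩
    have hzero : ∀ φ : E d → ℝ, ContDiff ℝ ∞ φ → HasCompactSupport φ → tsupport φ ⊆ Ω →
        ∑ F : T.Face, ∫ x : F.set, φ x.1 * ev (jumpPol v F) x.1 ∂F.surf = 0 := by
      intro φ hφ hc hs
      rw [← hid φ hφ hc hs]
      refine integral_eq_zero_of_ae ?_
      filter_upwards [hae] with x hx
      simp [hx]
    set W : Set (E d) := Ω \ ⋃ (F' : T.Face) (_ : F' ≠ F), F'.set with hW
    have hWo : IsOpen W := T.isOpen.sdiff (hclosed {F' | F' ≠ F})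
    have hloc : ∀ x ∈ F.set, x ∈ W → ev (jumpPol v F) x = 0 := by
      intro x hx hxW
      obtain ⟨χ, hχs, hχc, hχ, -, hχ1⟩ :=
        exists_contDiff_tsupport_subset (n := ⊤) (hWo.mem_nhds hxW)
      -- The test function is `χ ψ`, whose product with the jump is `ψ²`. Its support avoids all
      -- faces other than `F`, so the integral of `ψ²` over `F` vanishes.
      set ψ : E d → ℝ := fun y => χ y * ev (jumpPol v F) y with hψ
      have hψc : ContDiff ℝ ∞ ψ := hχ.mul (contDiff_ev _)
      have hφs : tsupport (fun y => χ y * ψ y) ⊆ W := (tsupport_mul_subset_left).trans hχs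
      have h1 := hzero (fun y => χ y * ψ y) (hχ.mul hψc) hχc.mul_right
        (hφs.trans Set.sdiff_subset)
      rw [Finset.sum_eq_single F] at h1
      · have h2 : ∫ y : F.set, ψ y.1 * ψ y.1 ∂F.surf = 0 := by
          rw [← h1]
          congr 1
          ext y
          simp only [hψ]
          ring
        have h3 := F.eq_zero_of_integral_sq hψc.continuous h2 x hx
        simpa [hψ, hχ1] using h3
      · intro F' _ hF'
        refine integral_eq_zero_of_ae (.of_forall fun y => ?_)
        have : χ y.1 * ψ y.1 = 0 := hout (φ := fun y => χ y * ψ y) hφs fun h => h.2 (by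
          simp only [Set.mem_iUnion]; exact ⟨F', hF', y.2⟩)
        simp [this]
      · simp
    intro x hx
    obtain ⟨z, rfl⟩ := F.set_subset_range hx
    exact Face.ev_eq_zero_of_open
      (isOpen_interior.inter (hWo.preimage F.isometry_param.continuous))
      (Face.exists_mem_notMem hF) (fun y hy => hloc _ (interior_subset (s := F.dom) hy.1) hy.2) z
  · intro h
    refine ⟨memLp_glue v, glueDiv v, memLp_glueDiv v, fun φ hφ hc hs => ?_⟩
    rw [integral_glue_gradient hd v (hφ.of_le (by simp)), add_eq_left]
    refine Finset.sum_eq_zero fun F _ => integral_eq_zero_of_ae (.of_forall fun x => ?_)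
    -- Jumps on boundary faces are unrestricted: these faces miss the open set `Ω`, where `φ` is
    -- supported.
    by_cases hF : F.IsBoundary
    · have h1 : x.1 ∉ Ω := fun hx => by
        have := hF x.2
        rw [T.isOpen.frontier_eq] at this
        exact this.2 hx
      simp [hout hs h1]
    · simp [h F hF x.1 x.2]

end Jump

/-! ### Normal traces of the RT and BDM spaces. -/

section Traces
variable {d : ℕ} {Ω : Set (E d)} {T : Mesh d Ω}

/-- The normal traces of `V(K)` on a face `F` lie in `M(F)`, and every member of `M(F)` is the
normal trace of a member of `V(K)` whose normal traces on the other faces vanish. -/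
structure HasNormalTraces (L : LocalSpaces T) : Prop where
  trace_mem : ∀ (K : T.Elem), ∀ F ∈ K.faces, ∀ v : L.V K,
    (fun x : F.set => vev v.1 x.1 ⬝ᵥ fun i => normal K F i) ∈ L.M F
  exists_lift : ∀ (K : T.Elem), ∀ F ∈ K.faces, ∀ μ : L.M F, ∃ v : L.V K,
    (∀ x : F.set, (vev v.1 x.1 ⬝ᵥ fun i => normal K F i) = μ.1 x) ∧
    ∀ F' ∈ K.faces, F' ≠ F → ∀ x : F'.set, (vev v.1 x.1 ⬝ᵥ fun i => normal K F' i) = 0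

theorem inner_eq_dotProduct (x y : E d) : inner ℝ x y = (fun i => x i) ⬝ᵥ fun i => y i := by
  simp [PiLp.inner_apply, dotProduct, mul_comm]

theorem Mesh.Face.sub_mem_dir {F : T.Face} {x y : E d} (hx : x ∈ F.set) (hy : y ∈ F.set) :
    x - y ∈ F.dir := by
  obtain ⟨z, rfl⟩ := F.set_subset_range hx
  obtain ⟨w, rfl⟩ := F.set_subset_range hy
  simp only [Face.param_apply, add_sub_add_right_eq_sub]
  exact F.dir.sub_mem z.2 w.2

theorem inner_normal_of_mem_dir (K : T.Elem) {F : T.Face} {x : E d} (hx : x ∈ F.dir) :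
    inner ℝ x (normal K F) = 0 :=
  (Submodule.mem_orthogonal _ _).1 (normal_mem_orthogonal K F) _ hx

theorem inner_sub_normal (K : T.Elem) {F : T.Face} {x y v : E d} (hx : x ∈ F.set) (hy : y ∈ F.set) :
    inner ℝ (x - v) (normal K F) = inner ℝ (y - v) (normal K F) := by
  have h : x - v = (x - y) + (y - v) := by abel
  rw [h, inner_add_left, inner_normal_of_mem_dir K (Face.sub_mem_dir hx hy), zero_add]

theorem Mesh.Face.subset_set (F : T.Face) {y : E d} (hy : y ∈ F.1) : y ∈ F.set :=
  subset_convexHull ℝ _ hy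

theorem Mesh.Face.opposite_mem {K : T.Elem} {F F' : T.Face} {v : E d}
    (hv : ∀ y ∈ K.1, y ≠ v → y ∈ F.1) (hF' : F' ∈ K.faces) (hne : F' ≠ F) : v ∈ F'.1 := by
  by_contra h
  apply hne
  have h1 : F'.1 ⊆ F.1 := fun y hy => hv y (Elem.mem_faces.1 hF' hy) fun h' => h (h' ▸ hy)
  exact Subtype.ext (Finset.eq_of_subset_of_card_le h1 (by rw [F.2.2, F'.2.2]))

theorem mem_Pk {k : ℕ} {p : Pol d} : p ∈ Pk d k ↔ p.totalDegree ≤ k :=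
  MvPolynomial.mem_restrictTotalDegree _ _ p

theorem mul_mem_Pk {k l : ℕ} {p q : Pol d} (hp : p ∈ Pk d k) (hq : q ∈ Pk d l) :
    p * q ∈ Pk d (k + l) :=
  mem_Pk.2 ((MvPolynomial.totalDegree_mul p q).trans (add_le_add (mem_Pk.1 hp) (mem_Pk.1 hq)))

theorem mem_PkVec {k : ℕ} {v : VPol d} : v ∈ PkVec d k ↔ ∀ i, v i ∈ Pk d k := by
  simp [PkVec, Submodule.mem_pi]

theorem mem_PkOn {S : Set (E d)} {k : ℕ} {μ : S → ℝ} :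
    μ ∈ PkOn S k ↔ ∃ p ∈ Pk d k, ∀ x, ev p x.1 = μ x := by
  simp only [PkOn, Submodule.mem_map, funext_iff]
  rfl

theorem normalTrace_mem_of_PkVec {k : ℕ} {v : VPol d} (hv : v ∈ PkVec d k) (n : E d)
    (S : Set (E d)) : (fun x : S => vev v x.1 ⬝ᵥ fun i => n i) ∈ PkOn S k := by
  refine mem_PkOn.2 ⟨∑ i, n i • v i, Submodule.sum_mem _ fun i _ =>
    Submodule.smul_mem _ _ (mem_PkVec.1 hv i), fun x => ?_⟩
  rw [ev_sum]
  exact Finset.sum_congr rfl fun i _ => by rw [ev_smul, mul_comm]; rfl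

/-- On a face `x·n` is constant, so the normal trace of `x p` keeps the degree of `p`. The lift is
`c⁻¹ (x - v) p`, with `v` the vertex opposite `F` and `c` its distance to the hyperplane of `F`:
there `(x - v)·n = c`, while every other face contains `v`, so `x - v` is tangential to it. -/
theorem hasNormalTraces_rtSpaces (T : Mesh d Ω) (k : ℕ) : HasNormalTraces (rtSpaces T k) where
  trace_mem := by
    rintro K F hF ⟨v, hv⟩
    obtain ⟨v₁, hv₁, v₂, ⟨p, hp, rfl⟩, rfl⟩ := Submodule.mem_sup.1 hv
    have h2 : (fun x : F.set => vev (xMul d p) x.1 ⬝ᵥ fun i => normal K F i) ∈ PkOn F.set k := by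
      refine mem_PkOn.2 ⟨(inner ℝ F.pt (normal K F)) • p, Submodule.smul_mem _ _ hp, fun x => ?_⟩
      have h3 := inner_sub_normal K (v := 0) (F.subset_set F.pt_mem) x.2
      rw [sub_zero, sub_zero] at h3
      rw [ev_smul, h3, inner_eq_dotProduct, dotProduct, Finset.sum_mul]
      refine Finset.sum_congr rfl fun i _ => ?_
      simp [vev, xMul]
      ring
    have h3 := Submodule.add_mem _ (normalTrace_mem_of_PkVec hv₁ (normal K F) F.set) h2
    refine (congrArg (· ∈ PkOn F.set k) (funext fun x => ?_)).mp h3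
    simp [add_dotProduct]
  exists_lift := by
    rintro K F hF ⟨μ, hμ⟩
    obtain ⟨p, hp, hpμ⟩ := mem_PkOn.1 hμ
    obtain ⟨v, hvK, hvF, hv⟩ := Face.exists_opposite hF
    set c := inner ℝ (F.pt - v) (normal K F) with hc
    have hc0 : 0 < c := inner_normal_pos hF hvK hvF hv F.pt_mem
    set r : VPol d := c⁻¹ • (xMul d p - fun i => v i • p) with hr
    have hrev : ∀ (x : E d) (n : E d), (vev r x ⬝ᵥ fun i => n i) =
        c⁻¹ * ev p x * inner ℝ (x - v) n := by
      intro x n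
      rw [inner_eq_dotProduct, dotProduct, dotProduct, Finset.mul_sum]
      refine Finset.sum_congr rfl fun i _ => ?_
      simp [hr, vev, xMul, sub_eq_add_neg, ev]
      ring
    have hmem : r ∈ RTk d k := by
      refine Submodule.smul_mem _ _ (Submodule.sub_mem _ ?_ ?_)
      · exact Submodule.mem_sup_right ⟨p, hp, rfl⟩
      · exact Submodule.mem_sup_left (mem_PkVec.2 fun i => Submodule.smul_mem _ _ hp)
    refine ⟨⟨r, hmem⟩, fun x => ?_, fun F' hF' hne x => ?_⟩
    · rw [hrev, inner_sub_normal K x.2 (F.subset_set F.pt_mem), ← hc, hpμ]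
      field_simp
    · rw [hrev, inner_normal_of_mem_dir K (Face.sub_mem_dir x.2
        (F'.subset_set (Face.opposite_mem hv hF' hne))), mul_zero]

/-- The barycentric coordinates of an element as polynomials. -/
noncomputable def Mesh.Elem.coordPol (K : T.Elem) (l : K.1) : Pol d :=
  MvPolynomial.C (K.basis.coord l 0) +
    ∑ i, (K.basis.coord l).linear (EuclideanSpace.single i 1) • MvPolynomial.X i

theorem Mesh.Elem.ev_coordPol (K : T.Elem) (l : K.1) (x : E d) :
    ev (K.coordPol l) x = K.basis.coord l x := by
  have h1 : K.basis.coord l x = (K.basis.coord l).linear x + K.basis.coord l 0 := by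
    have h := congrFun (K.basis.coord l).decomp x
    simpa using h
  have h2 : x = ∑ i, x i • EuclideanSpace.single i (1 : ℝ) := by
    ext j
    simp [Pi.single_apply]
  rw [h1, Mesh.Elem.coordPol, ev_add, ev_C, ev_sum, add_comm]
  congr 1
  conv_rhs => rw [h2]
  rw [map_sum]
  refine Finset.sum_congr rfl fun i _ => ?_
  rw [ev_smul, ev_X, map_smul, smul_eq_mul, mul_comm]

theorem C_mem_Pk (c : ℝ) (k : ℕ) : (MvPolynomial.C c : Pol d) ∈ Pk d k :=
  mem_Pk.2 (by rw [MvPolynomial.totalDegree_C]; exact Nat.zero_le _)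

theorem X_mem_Pk (i : Fin d) : (MvPolynomial.X i : Pol d) ∈ Pk d 1 :=
  mem_Pk.2 (by rw [MvPolynomial.totalDegree_X])

theorem Mesh.Elem.coordPol_mem (K : T.Elem) (l : K.1) : K.coordPol l ∈ Pk d 1 :=
  Submodule.add_mem _ (C_mem_Pk _ _)
    (Submodule.sum_mem _ fun i _ => Submodule.smul_mem _ _ (X_mem_Pk i))

/-- A polynomial of degree at most `k + 1` is a combination of the barycentric coordinates with
coefficients of degree at most `k`. -/
theorem Mesh.Elem.exists_eq_sum_coord_mul (K : T.Elem) {k : ℕ} {p : Pol d}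
    (hp : p ∈ Pk d (k + 1)) :
    ∃ s : K.1 → Pol d, (∀ l, s l ∈ Pk d k) ∧ ∀ x, ev p x = ∑ l, K.basis.coord l x * ev (s l) x := by
  have hmon : ∀ m ∈ p.support, ∃ s : K.1 → Pol d, (∀ l, s l ∈ Pk d k) ∧
      ∀ x, ev (MvPolynomial.monomial m (p.coeff m)) x = ∑ l, K.basis.coord l x * ev (s l) x := by
    intro m hm
    have hdeg : m.degree ≤ k + 1 := by
      have := (MvPolynomial.le_totalDegree hm).trans (mem_Pk.1 hp)
      exact this
    -- The constant monomial is multiplied by the sum of the barycentric coordinates, which is one.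
    -- In any other, a factor `x_j` is split off and written as the combination of the `j`-th
    -- components of the vertices.
    by_cases hm0 : m = 0
    · refine ⟨fun _ => MvPolynomial.C (p.coeff m), fun _ => C_mem_Pk _ _, fun x => ?_⟩
      rw [hm0, ← MvPolynomial.C_apply, ← Finset.sum_mul, K.basis.sum_coord_apply_eq_one, one_mul]
    · obtain ⟨j, hj⟩ := Finsupp.ne_iff.1 hm0
      obtain ⟨m', rfl⟩ : ∃ m', m = m' + Finsupp.single j 1 :=
        ⟨m - Finsupp.single j 1, (tsub_add_cancel_of_le
          (Finsupp.single_le_iff.2 (Nat.one_le_iff_ne_zero.2 hj))).symm⟩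
      set q : Pol d := MvPolynomial.monomial m' (p.coeff (m' + Finsupp.single j 1)) with hq
      have hqk : q ∈ Pk d k := by
        refine mem_Pk.2 ((MvPolynomial.totalDegree_monomial_le _ _).trans ?_)
        rw [map_add, Finsupp.degree_single] at hdeg
        have h' : m'.degree ≤ k := by omega
        exact h'
      refine ⟨fun l => l.1 j • q, fun l => Submodule.smul_mem _ _ hqk, fun x => ?_⟩
      have h1 : MvPolynomial.monomial (m' + Finsupp.single j 1) (p.coeff (m' + Finsupp.single j 1)) =
          q * MvPolynomial.X j := by
        rw [hq, MvPolynomial.X, MvPolynomial.monomial_mul, mul_one]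
      have h2 : x j = ∑ l, K.basis.coord l x * l.1 j := by
        have h3 := congrArg (fun y : E d => y j) (K.basis.linear_combination_coord_eq_self x)
        simpa using h3.symm
      rw [h1, ev_mul, ev_X, h2, Finset.mul_sum]
      refine Finset.sum_congr rfl fun l _ => ?_
      rw [ev_smul]
      ring
  choose! s hs hsx using hmon
  refine ⟨fun l => ∑ m ∈ p.support, s m l, fun l => Submodule.sum_mem _ fun m hm => hs m hm l,
    fun x => ?_⟩
  conv_lhs => rw [p.as_sum]
  rw [ev_sum, Finset.sum_congr rfl fun m hm => hsx m hm x, Finset.sum_comm]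
  refine Finset.sum_congr rfl fun l _ => ?_
  rw [ev_sum, Finset.mul_sum]

/-- As `k ≥ 1`, the extension `p` of `μ` can be written `∑ λ_l s_l`, with `λ_l` the barycentric
coordinates and `s_l` of one degree less. The lift is `c⁻¹ ∑ λ_l s_l (l - v)`. On `F` each vertex
`l` of `F` has `(l - v)·n = c`, which returns `p`. On another face `F'` either `λ_l = 0`, or `l` and
`v` both belong to `F'` and `l - v` is tangential. -/
theorem hasNormalTraces_bdmSpaces (T : Mesh d Ω) {k : ℕ} (hk : 1 ≤ k) :
    HasNormalTraces (bdmSpaces T k) where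
  trace_mem := fun K F _ v => normalTrace_mem_of_PkVec v.2 _ _
  exists_lift := by
    obtain ⟨k, rfl⟩ : ∃ k', k = k' + 1 := ⟨k - 1, by omega⟩
    rintro K F hF ⟨μ, hμ⟩
    obtain ⟨p, hp, hpμ⟩ := mem_PkOn.1 hμ
    obtain ⟨v, hvK, hvF, hv⟩ := Face.exists_opposite hF
    have hd := F.one_le_dim
    obtain ⟨s, hs, hsx⟩ := K.exists_eq_sum_coord_mul hp
    set c := inner ℝ (F.pt - v) (normal K F) with hc
    have hc0 : 0 < c := inner_normal_pos hF hvK hvF hv F.pt_mem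
    set r : VPol d := fun i => ∑ l : K.1, (c⁻¹ * (l.1 - v) i) • (K.coordPol l * s l) with hr
    have hrev : ∀ (x : E d) (n : E d), (vev r x ⬝ᵥ fun i => n i) =
        ∑ l : K.1, c⁻¹ * (K.basis.coord l x * ev (s l) x) * inner ℝ (l.1 - v) n := by
      intro x n
      simp only [inner_eq_dotProduct, dotProduct, vev, hr, ev_sum, ev_smul, ev_mul,
        Elem.ev_coordPol, Finset.mul_sum, Finset.sum_mul]
      rw [Finset.sum_comm]
      exact Finset.sum_congr rfl fun l _ => Finset.sum_congr rfl fun i _ => by ring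
    have hmem : r ∈ PkVec d (k + 1) := by
      refine mem_PkVec.2 fun i => Submodule.sum_mem _ fun l _ => Submodule.smul_mem _ _ ?_
      rw [add_comm]
      exact mul_mem_Pk (K.coordPol_mem l) (hs l)
    have hcoord : ∀ F' ∈ K.faces, ∀ l : K.1, l.1 ∉ F'.1 → ∀ x ∈ F'.set, K.basis.coord l x = 0 := by
      intro F' hF' l hl x hx
      have h1 : F'.set ⊆ (K.facet hd l).set := convexHull_mono fun y hy =>
        Elem.mem_facet.2 ⟨fun h => hl (by subst h; exact hy), Elem.mem_faces.1 hF' hy⟩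
      exact (Elem.mem_facet_set.1 (h1 hx)).2
    refine ⟨⟨r, hmem⟩, fun x => ?_, fun F' hF' hne x => ?_⟩
    · refine Eq.trans ?_ ((hsx x.1).symm.trans (hpμ x))
      rw [hrev]
      refine Finset.sum_congr rfl fun l _ => ?_
      by_cases hl : l.1 ∈ F.1
      · rw [inner_sub_normal K (F.subset_set hl) (F.subset_set F.pt_mem), ← hc]
        field_simp
      · rw [hcoord F hF l hl x.1 x.2]
        ring
    · rw [hrev]
      refine Finset.sum_eq_zero fun l _ => ?_
      by_cases hl : l.1 ∈ F'.1
      · rw [inner_normal_of_mem_dir K (Face.sub_mem_dir (F'.subset_set hl)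
          (F'.subset_set (Face.opposite_mem hv hF' hne))), mul_zero]
      · rw [hcoord F' hF' l hl x.1 x.2]
        ring

end Traces

/-! ### Hybridization of the expanded mixed method. -/

section Hybridization
variable {d : ℕ} {Ω : Set (E d)} {T : Mesh d Ω} {L : LocalSpaces T}

theorem HasNormalTraces.jump_mem (hL : HasNormalTraces L) (v : L.Vh) (F : T.Face) :
    (fun x : F.set => ev (jumpPol v F) x.1) ∈ L.M F := by
  classical
  have h : (fun x : F.set => ev (jumpPol v F) x.1) = ∑ K : T.Elem with F ∈ K.faces,
      fun x : F.set => vev (v K).1 x.1 ⬝ᵥ fun i => normal K F i := by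
    funext x
    rw [ev_jumpPol, Finset.sum_apply]
  rw [h]
  exact Submodule.sum_mem _ fun K hK => hL.trace_mem K F (Finset.mem_filter.1 hK).2 (v K)

/-- The jump on each face belongs to `M(F)`, so it can itself serve as the multiplier; orthogonality
to `M_h` then forces it to vanish. -/
theorem HasNormalTraces.mem_ConformingV_iff (hd : 1 ≤ d) (hL : HasNormalTraces L) (v : L.Vh) :
    v ∈ ConformingV L ↔ ∀ μ : L.Mh, innerBdryInt (trM μ) (trN v) = 0 := by
  classical
  rw [WGHDG.mem_ConformingV_iff hd]
  constructor
  · intro h μ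
    rw [innerBdryInt_trM_trN]
    refine Finset.sum_eq_zero fun F hF => integral_eq_zero_of_ae (.of_forall fun x => ?_)
    simp [h F (Finset.mem_filter.1 hF).2 x.1 x.2]
  · intro h F hF x hx
    have h1 := h fun F => ⟨_, hL.jump_mem v F⟩
    rw [innerBdryInt_trM_trN, Finset.sum_eq_zero_iff_of_nonneg
      fun F _ => integral_nonneg fun x => mul_self_nonneg _] at h1
    exact F.eq_zero_of_integral_sq (continuous_ev _)
      (h1 F (Finset.mem_filter.2 ⟨Finset.mem_univ _, hF⟩)) x hx

/-- Normal traces lie in `M(F)`, so on boundary faces they cannot tell `uD` from its projection. -/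
theorem innerBdry_eq_ext {uD : E d → ℝ} (hL : HasNormalTraces L) {uhat : L.Mh}
    (hb : ∀ F : T.Face, F.IsBoundary → ∀ μ : L.M F,
      ∫ x, (uhat F).1 x * μ.1 x ∂F.surf = ∫ x : F.set, uD x.1 * μ.1 x ∂F.surf) (v : L.Vh) :
    innerBdry (trM uhat) (trN v) = innerBdryInt (trM uhat) (trN v) + innerBdryExt uD (trN v) := by
  classical
  simp only [innerBdry, innerBdryInt, innerBdryExt, ← Finset.sum_add_distrib]
  refine Finset.sum_congr rfl fun K _ => ?_
  rw [← Finset.sum_filter_add_sum_filter_not K.faces fun F => F.IsBoundary, add_comm]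
  congr 1
  refine Finset.sum_congr rfl fun F hF => ?_
  obtain ⟨hFK, hFb⟩ := Finset.mem_filter.1 hF
  exact hb F hFb ⟨_, hL.trace_mem K F hFK (v K)⟩

variable {a : E d → Matrix (Fin d) (Fin d) ℝ} {f uD : E d → ℝ}

theorem IsHybridMixed.isExpandedMixed (hd : 1 ≤ d) (hL : HasNormalTraces L) {q g : L.Vh} {u : L.Wh}
    {uhat : L.Mh} (h : IsHybridMixed L a f uD q g u uhat) : IsExpandedMixed L a f uD q g u := by
  refine ⟨(hL.mem_ConformingV_iff hd q).2 h.continuity, fun v hv => ?_, h.flux, h.conservation⟩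
  rw [h.gradient v, innerBdry_eq_ext hL h.boundary, (hL.mem_ConformingV_iff hd v).1 hv, zero_add]

/-- The pairing `⟨μ, v · n⟩_{∂𝒯_h}` between `M_h` and `V_h`. -/
noncomputable def tracePairing (L : LocalSpaces T) : L.Mh →ₗ[ℝ] L.Vh →ₗ[ℝ] ℝ :=
  LinearMap.mk₂ ℝ (fun μ v => innerBdry (trM μ) (trN v))
    (fun μ μ' v => by
      have h : trM (μ + μ') = trM μ + trM μ' := rfl
      rw [h]
      exact innerBdry_add_left
        (fun K F _ => F.integrable_surf ((continuous_trM μ K F).mul (continuous_trN v K F)))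
        (fun K F _ => F.integrable_surf ((continuous_trM μ' K F).mul (continuous_trN v K F))))
    (fun c μ v => by
      simp only [innerBdry, smul_eq_mul, Finset.mul_sum, ← integral_const_mul, ← mul_assoc]
      rfl)
    (fun μ v v' => by
      have h : trN (v + v') = trN v + trN v' := by
        funext K F x
        simp [trN, add_dotProduct]
      rw [h, innerBdry_comm, innerBdry_comm _ (trN v), innerBdry_comm _ (trN v')]
      exact innerBdry_add_left
        (fun K F _ => F.integrable_surf ((continuous_trN v K F).mul (continuous_trM μ K F)))
        (fun K F _ => F.integrable_surf ((continuous_trN v' K F).mul (continuous_trM μ K F))))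
    (fun c μ v => by
      have h : trN (c • v) = c • trN v := by
        funext K F x
        simp [trN]
      rw [h]
      simp only [innerBdry, smul_eq_mul, Finset.mul_sum, ← integral_const_mul, Pi.smul_apply,
        mul_left_comm c])

/-- The lift of `μ F` into a single element at `F` is paired with `μ` to the integral of `μ²` over
`F`, all other faces contributing nothing. -/
theorem HasNormalTraces.tracePairing_injective (hL : HasNormalTraces L) :
    Function.Injective (tracePairing L) := by
  classical
  rw [injective_iff_map_eq_zero]
  intro μ hμ
  funext F
  obtain ⟨K, hF⟩ := F.exists_elem
  obtain ⟨r, hr, hr'⟩ := hL.exists_lift K F hF (μ F)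
  have h1 : innerBdry (trM μ) (trN (Pi.single K r : L.Vh)) = 0 :=
    congrArg (fun B : L.Vh →ₗ[ℝ] ℝ => B (Pi.single K r)) hμ
  rw [innerBdry, Finset.sum_eq_single K, Finset.sum_eq_single F] at h1
  · refine L.eq_zero_of_integral_sq (μ := μ F) ?_
    rw [← h1]
    congr 1
    ext x
    simp only [trN, trM, Pi.single_eq_same]
    rw [hr]
  · intro F' hF' hne
    refine integral_eq_zero_of_ae (.of_forall fun x => ?_)
    simp only [trN, Pi.single_eq_same]
    rw [hr' F' hF' hne x, mul_zero]
    rfl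
  · exact fun h => absurd hF h
  · intro K' _ hne
    refine Finset.sum_eq_zero fun F' _ => integral_eq_zero_of_ae (.of_forall fun x => ?_)
    simp [trN, Pi.single_eq_of_ne hne]
  · simp

/-- The functional `v ↦ (g, v) + (u, ∇·v)`. -/
noncomputable def mixedFunctional (g : L.Vh) (u : L.Wh) : L.Vh →ₗ[ℝ] ℝ where
  toFun v := innerV g v + innerVol (volW u) (volDiv v)
  map_add' v v' := by
    have h1 : innerV g (v + v') = innerV g v + innerV g v' := by
      have h : ∀ v : L.Vh, innerV g v = ∑ K, locV K (g K).1 (v K).1 := fun v => rfl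
      simp only [h, Pi.add_apply, Submodule.coe_add, map_add, Finset.sum_add_distrib]
    have h2 : innerVol (volW u) (volDiv (v + v')) =
        innerVol (volW u) (volDiv v) + innerVol (volW u) (volDiv v') := by
      simp only [innerVol, ← Finset.sum_add_distrib]
      refine Finset.sum_congr rfl fun K _ => ?_
      simp only [volW, volDiv, Pi.add_apply, Submodule.coe_add, pdiv_add, ev_add, mul_add]
      exact integral_add (K.integrable_of_continuous (by fun_prop))
        (K.integrable_of_continuous (by fun_prop))
    rw [h1, h2]
    ring
  map_smul' c v := by
    have h1 : innerV g (c • v) = c * innerV g v := by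
      have h : ∀ v : L.Vh, innerV g v = ∑ K, locV K (g K).1 (v K).1 := fun v => rfl
      simp only [h, Pi.smul_apply, Submodule.coe_smul, map_smul, smul_eq_mul, Finset.mul_sum]
    have h2 : innerVol (volW u) (volDiv (c • v)) = c * innerVol (volW u) (volDiv v) := by
      simp only [innerVol, Finset.mul_sum]
      refine Finset.sum_congr rfl fun K _ => ?_
      simp only [volW, volDiv, Pi.smul_apply, Submodule.coe_smul, pdiv_smul, ev_smul,
        ← integral_const_mul, mul_left_comm c]
    rw [h1, h2, RingHom.id_apply, smul_eq_mul]
    ring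

theorem Mesh.Face.IsBoundary.integrable_surf {F : T.Face} (hF : F.IsBoundary)
    (huD : MemLp uD 2 ((Measure.euclideanHausdorffMeasure (d - 1)).restrict (frontier Ω))) :
    Integrable (fun x : F.set => uD x.1) F.surf := by
  have h1 : MemLp uD 2 ((Measure.euclideanHausdorffMeasure (d - 1)).restrict F.set) :=
    huD.mono_measure (Measure.restrict_mono hF le_rfl)
  have h2 : IsFiniteMeasure
      ((Measure.euclideanHausdorffMeasure (d - 1) : Measure (E d)).restrict F.set) := by
    refine ⟨?_⟩
    have h3 := measure_lt_top F.surf Set.univ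
    rw [Face.surf, Measure.comap_apply _ Subtype.val_injective
      (fun s hs => F.measurableSet_set.subtype_image hs) _ MeasurableSet.univ] at h3
    simpa using h3
  exact (integrableOn_iff_comap_subtypeVal F.measurableSet_set).1 (h1.integrable one_le_two)

/-- The `L²(F)`-projection onto `M(F)`. -/
theorem LocalSpaces.exists_projection (L : LocalSpaces T) (F : T.Face) {η : F.set → ℝ}
    (hη : Integrable η F.surf) :
    ∃ ζ : L.M F, ∀ μ : L.M F, ∫ x, ζ.1 x * μ.1 x ∂F.surf = ∫ x, η x * μ.1 x ∂F.surf := by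
  have := L.finM F
  have hc := fun μ : L.M F => L.continuous_M μ
  let B : L.M F →ₗ[ℝ] L.M F →ₗ[ℝ] ℝ := LinearMap.mk₂ ℝ (fun ζ μ => ∫ x, ζ.1 x * μ.1 x ∂F.surf)
    (fun ζ ζ' μ => by
      simp only [Submodule.coe_add, Pi.add_apply, add_mul]
      exact integral_add (F.integrable_surf ((hc ζ).mul (hc μ)))
        (F.integrable_surf ((hc ζ').mul (hc μ))))
    (fun c ζ μ => by
      simp only [Submodule.coe_smul, Pi.smul_apply, smul_eq_mul, mul_assoc]
      exact integral_const_mul _ _)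
    (fun ζ μ μ' => by
      simp only [Submodule.coe_add, Pi.add_apply, mul_add]
      exact integral_add (F.integrable_surf ((hc ζ).mul (hc μ)))
        (F.integrable_surf ((hc ζ).mul (hc μ'))))
    (fun c ζ μ => by
      simp only [Submodule.coe_smul, Pi.smul_apply, smul_eq_mul, mul_left_comm _ c]
      exact integral_const_mul _ _)
  let ℓ : L.M F →ₗ[ℝ] ℝ :=
    { toFun := fun μ => ∫ x, η x * μ.1 x ∂F.surf
      map_add' := fun μ μ' => by
        simp only [Submodule.coe_add, Pi.add_apply, mul_add]
        exact integral_add (F.integrable_mul hη (hc μ)) (F.integrable_mul hη (hc μ'))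
      map_smul' := fun c μ => by
        simp only [Submodule.coe_smul, Pi.smul_apply, smul_eq_mul, mul_left_comm _ c]
        exact integral_const_mul _ _ }
  exact (existsUnique_riesz B (fun μ h => L.eq_zero_of_integral_sq h) ℓ).exists

/-- The projection of `M_h` onto its members supported on the faces that do not lie on `∂Ω`. -/
noncomputable def interiorProj (L : LocalSpaces T) : L.Mh →ₗ[ℝ] L.Mh where
  toFun := interiorPart
  map_add' μ μ' := by
    funext F
    by_cases hF : F.IsBoundary
    · simp [interiorPart_apply_of_isBoundary _ hF]
    · simp [interiorPart_apply_of_not_isBoundary _ hF]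
  map_smul' c μ := by
    funext F
    by_cases hF : F.IsBoundary
    · simp [interiorPart_apply_of_isBoundary _ hF]
    · simp [interiorPart_apply_of_not_isBoundary _ hF]

theorem IsExpandedMixed.existsUnique_isHybridMixed (hd : 1 ≤ d) (hL : HasNormalTraces L)
    (huD : MemLp uD 2 ((Measure.euclideanHausdorffMeasure (d - 1)).restrict (frontier Ω)))
    {q g : L.Vh} {u : L.Wh} (h : IsExpandedMixed L a f uD q g u) :
    ∃! uhat : L.Mh, IsHybridMixed L a f uD q g u uhat := by
  classical
  have hfinV : ∀ K, FiniteDimensional ℝ (L.V K) := L.finV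
  have hfinM : ∀ F, FiniteDimensional ℝ (L.M F) := L.finM
  have hproj : ∀ F : T.Face, ∃ ζ : L.M F, F.IsBoundary → ∀ μ : L.M F,
      ∫ x, ζ.1 x * μ.1 x ∂F.surf = ∫ x : F.set, uD x.1 * μ.1 x ∂F.surf := by
    intro F
    by_cases hF : F.IsBoundary
    · obtain ⟨ζ, hζ⟩ := L.exists_projection F (hF.integrable_surf huD)
      exact ⟨ζ, fun _ => hζ⟩
    · exact ⟨0, fun h => absurd h hF⟩
  choose ζ hζ using hproj
  let B₀ : L.Mh →ₗ[ℝ] Module.Dual ℝ L.Vh := tracePairing L ∘ₗ interiorProj L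
  have hB₀ : ∀ μ v, B₀ μ v = innerBdryInt (trM μ) (trN v) := fun μ v => by
    rw [← innerBdryInt_interiorPart, ← innerBdry_trM_eq
      fun F hF => interiorPart_apply_of_isBoundary μ hF]
    rfl
  let ℓ : Module.Dual ℝ L.Vh := mixedFunctional g u - tracePairing L ζ
  -- In finite dimension the range of `B₀` is the annihilator of its coannihilator. The latter
  -- consists of the conforming fields, on which `ℓ` vanishes by the mixed gradient equation.
  have hℓ : ℓ ∈ LinearMap.range B₀ := by
    rw [← Subspace.dualCoannihilator_dualAnnihilator_eq (W := LinearMap.range B₀),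
      Submodule.mem_dualAnnihilator]
    intro v hv
    rw [Submodule.mem_dualCoannihilator] at hv
    have hv' : ∀ μ : L.Mh, innerBdryInt (trM μ) (trN v) = 0 := fun μ => by
      rw [← hB₀]; exact hv _ ⟨μ, rfl⟩
    have h1 := h.gradient v ((hL.mem_ConformingV_iff hd v).2 hv')
    have h2 := innerBdry_eq_ext hL hζ v
    rw [hv', zero_add, ← h1] at h2
    exact sub_eq_zero.2 h2.symm
  obtain ⟨μ, hμ⟩ := hℓ
  -- `ζ` carries the boundary data, and the interior multiplier corrects the gradient equation
  -- without disturbing them.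
  refine ⟨ζ + interiorPart μ, ⟨fun v => ?_, h.flux, h.conservation,
    (hL.mem_ConformingV_iff hd q).1 h.conforming, fun F hF ν => ?_⟩, fun uhat' h' => ?_⟩
  · have h1 : tracePairing L (interiorPart μ) v = (mixedFunctional g u - tracePairing L ζ) v :=
      congrArg (fun B : Module.Dual ℝ L.Vh => B v) hμ
    have h2 : tracePairing L (ζ + interiorPart μ) v = mixedFunctional g u v := by
      rw [map_add, LinearMap.add_apply, h1, LinearMap.sub_apply]
      ring
    exact h2.symm
  · rw [Pi.add_apply, interiorPart_apply_of_isBoundary μ hF, add_zero]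
    exact hζ F hF ν
  -- The gradient equation alone prescribes the pairing of the multiplier with every `v` in `V_h`,
  -- which gives uniqueness.
  · refine hL.tracePairing_injective (LinearMap.ext fun v => ?_)
    have h1 : tracePairing L (interiorPart μ) v = (mixedFunctional g u - tracePairing L ζ) v :=
      congrArg (fun B : Module.Dual ℝ L.Vh => B v) hμ
    rw [map_add, LinearMap.add_apply, h1, LinearMap.sub_apply, add_sub_cancel]
    exact (h'.gradient v).symm

end Hybridization
end WGHDG

theorem mainTheorem1 (d : ℕ) (hd : 1 ≤ d) (Ω : Set (WGHDG.E d)) (T : WGHDG.Mesh d Ω)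
    (a : WGHDG.E d → Matrix (Fin d) (Fin d) ℝ)
    (ha : ∀ i j, MemLp (fun x => a x i j) ⊤ (volume.restrict Ω))
    (f : WGHDG.E d → ℝ) (hf : MemLp f 2 (volume.restrict Ω))
    (uD : WGHDG.E d → ℝ)
    (huD : MemLp uD 2 ((Measure.euclideanHausdorffMeasure (d - 1)).restrict (frontier Ω))) :
    -- arbitrary local spaces
    (∀ L : WGHDG.LocalSpaces T,
      -- the maps `G` and `Q` are well defined on `L²(𝒯_h) × L²(∂𝒯_h)`, and `G` is the
      -- discrete weak gradient
      (∀ (w : WGHDG.VolFun T) (what : WGHDG.BdryFun T),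
        WGHDG.MemL2Vol w → WGHDG.MemL2Bdry what →
        (∀ G : L.Vh, WGHDG.IsG L w what G ↔ G = WGHDG.GMap L w what) ∧
        (∀ Q : L.Vh, WGHDG.IsQ L a (WGHDG.GMap L w what) Q ↔ Q = WGHDG.QMap L a w what) ∧
        (∀ (K : T.Elem) (g : L.V K), WGHDG.IsWeakGradient L K (w K) (what K) g ↔
          g = WGHDG.GMap L w what K)) ∧
      -- and linear
      (∀ (s : ℝ) (w w' : WGHDG.VolFun T) (what what' : WGHDG.BdryFun T),
        WGHDG.MemL2Vol w → WGHDG.MemL2Bdry what → WGHDG.MemL2Vol w' → WGHDG.MemL2Bdry what' →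
        WGHDG.GMap L (s • w + w') (s • what + what') =
          s • WGHDG.GMap L w what + WGHDG.GMap L w' what' ∧
        WGHDG.QMap L a (s • w + w') (s • what + what') =
          s • WGHDG.QMap L a w what + WGHDG.QMap L a w' what') ∧
      -- elimination of `g_h` and `q_h`, for any stabilization function
      (∀ τ : WGHDG.BdryFun T, WGHDG.MemLinfBdry τ →
        ∀ (q g : L.Vh) (u : L.Wh) (uhat : L.Mh),
          WGHDG.IsHDG L a τ f uD q g u uhat ↔
            g = WGHDG.GMap L (WGHDG.volW u) (WGHDG.trM uhat) ∧
            q = WGHDG.QMap L a (WGHDG.volW u) (WGHDG.trM uhat) ∧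
            uhat ∈ WGHDG.MhBC L uD ∧
            ∀ (w : L.Wh) (what : L.Mh), what ∈ WGHDG.MhBC L 0 →
              WGHDG.innerA a (WGHDG.GMap L (WGHDG.volW u) (WGHDG.trM uhat))
                  (WGHDG.GMap L (WGHDG.volW w) (WGHDG.trM what)) +
                WGHDG.innerBdry (τ * (WGHDG.trW u - WGHDG.trM uhat))
                  (WGHDG.trW w - WGHDG.trM what) =
              WGHDG.innerVol (fun _ => f) (WGHDG.volW w)) ∧
      -- without stabilization, the result is the weak Galerkin scheme
      (∀ (q g : L.Vh) (u : L.Wh) (uhat : L.Mh),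
        WGHDG.IsHDG L a 0 f uD q g u uhat ↔
          g = WGHDG.GMap L (WGHDG.volW u) (WGHDG.trM uhat) ∧
          q = WGHDG.QMap L a (WGHDG.volW u) (WGHDG.trM uhat) ∧
          WGHDG.IsWG L a f uD u uhat)) ∧
    -- the two pairs of spaces: the method is the hybridized expanded mixed method
    (∀ L : WGHDG.LocalSpaces T,
      ((∃ k : ℕ, 1 ≤ k ∧ L = WGHDG.bdmSpaces T k) ∨ (∃ k : ℕ, L = WGHDG.rtSpaces T k)) →
      (∀ (q g : L.Vh) (u : L.Wh) (uhat : L.Mh),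
        WGHDG.IsHDG L a 0 f uD q g u uhat ↔ WGHDG.IsHybridMixed L a f uD q g u uhat) ∧
      (∀ (q g : L.Vh) (u : L.Wh) (uhat : L.Mh),
        WGHDG.IsHybridMixed L a f uD q g u uhat ↔
          g = WGHDG.GMap L (WGHDG.volW u) (WGHDG.trM uhat) ∧
          q = WGHDG.QMap L a (WGHDG.volW u) (WGHDG.trM uhat) ∧
          WGHDG.IsWG L a f uD u uhat) ∧
      (∀ (q g : L.Vh) (u : L.Wh) (uhat : L.Mh),
        WGHDG.IsHybridMixed L a f uD q g u uhat → WGHDG.IsExpandedMixed L a f uD q g u) ∧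
      (∀ (q g : L.Vh) (u : L.Wh), WGHDG.IsExpandedMixed L a f uD q g u →
        ∃! uhat : L.Mh, WGHDG.IsHybridMixed L a f uD q g u uhat)) := by
  refine ⟨fun L => ⟨fun w what hw hwhat => ⟨WGHDG.isG_iff_eq_GMap hw hwhat,
    WGHDG.isQ_iff_eq_QMap ha w what, WGHDG.isWeakGradient_iff_eq_GMap hw hwhat⟩,
    fun s w w' what what' hw hm hw' hm' => ⟨WGHDG.GMap_comb hw hm hw' hm' s,
      WGHDG.QMap_comb ha hw hm hw' hm' s⟩,
    fun τ hτ => WGHDG.isHDG_iff hd ha f uD hτ, WGHDG.isHDG_zero_iff_isWG hd ha f uD⟩,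
    fun L hL => ?_⟩
  -- The two pairs of spaces enter the hybridization only through their normal traces.
  have hT : WGHDG.HasNormalTraces L := by
    rcases hL with ⟨k, hk, rfl⟩ | ⟨k, rfl⟩
    · exact WGHDG.hasNormalTraces_bdmSpaces T hk
    · exact WGHDG.hasNormalTraces_rtSpaces T k
  exact ⟨WGHDG.isHDG_zero_iff_isHybridMixed hd f uD,
    fun q g u uhat => (WGHDG.isHDG_zero_iff_isHybridMixed hd f uD q g u uhat).symm.trans
      (WGHDG.isHDG_zero_iff_isWG hd ha f uD q g u uhat),
    fun q g u uhat h => h.isExpandedMixed hd hT,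
    fun q g u h => h.existsUnique_isHybridMixed hd hT huD⟩
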